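/- For a real $n\times n$ matrix $H=(h_{ij})$ write $\|H\|_1=\sum_{i,j}|h_{ij}|$, and let $J$ be the all-ones matrix and $\langle X,Y\rangle=\sum_{i,j}x_{ij}y_{ij}$. For a symmetric matrix $A\in\mathbb{R}^{n\times n}$ consider the linear program $$(\mathrm{P})\qquad \min\ \langle J,H^+\rangle+\langle J,H^-\rangle\quad\text{s.t.}\quad A(H^+-H^-)A=A,\quad H^+,H^-\ge 0 \text{ (entrywise)},$$ which is the LP for $\min\{\|H\|_1 : AHA=A\}$ with $H:=H^+-H^-$, and the linear program $(\mathrm{P}_{\mathrm{sym}})$, the LP for $\min\{\|H\|_1 : AHA=A,\ H^\top=H\}$, obtained from $(\mathrm{P})$ by adding the constraint $(H^+-H^-)^\top=H^+-H^-$. Suppose that $A\in\mathbb{R}^{n\times n}$ is symmetric of rank $r$. (1) For every extreme point $(H^+,H^-)$ of the feasible region of $(\mathrm{P})$ (in particular, for every extreme optimal solution), the matrix $H=H^+-H^-$ has at most $r^2$ nonzero entries. This bound is sharp for all $n\ge r\ge 1$: for all such $n,r$ there is a symmetric $A\in\mathbb{R}^{n\times n}$ of rank $r$ for which $(\mathrm{P})$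 has a unique optimal solution, this solution is an extreme point of the feasible region, and its $H$ has exactly $r^2$ nonzero entries. (2) For every extreme point $(H^+,H^-)$ of the feasible region of $(\mathrm{P}_{\mathrm{sym}})$ (in particular, for every extreme optimal solution), the matrix $H=H^+-H^-$ has at most $r^2+r$ nonzero entries. This bound is sharp whenever $n-2\ge r\ge 3$: for all such $n,r$ there is a symmetric $A\in\mathbb{R}^{n\times n}$ of rank $r$ for which $(\mathrm{P}_{\mathrm{sym}})$ has a unique optimal solution, this solution is an extreme point of the feasible region, and its $H$ has exactly $r^2+r$ nonzero entries. -/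

import Mathlib

/-- The feasible region, in the variables `(H⁺, H⁻)`, of the linear program
`min ⟨J, H⁺⟩ + ⟨J, H⁻⟩` subject to `A (H⁺ - H⁻) A = A`, `H⁺ ≥ 0`, `H⁻ ≥ 0`,
which is the LP for `min {‖H‖₁ : A H A = A}` with `H = H⁺ - H⁻`. -/
def ginvRegion {n : ℕ} (A : Matrix (Fin n) (Fin n) ℝ) :
    Set (Matrix (Fin n) (Fin n) ℝ × Matrix (Fin n) (Fin n) ℝ) :=
  {p | A * (p.1 - p.2) * A = A ∧ (∀ i j, 0 ≤ p.1 i j) ∧ (∀ i j, 0 ≤ p.2 i j)}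

/-- The feasible region of the LP for `min {‖H‖₁ : A H A = A, Hᵀ = H}`, `H = H⁺ - H⁻`. -/
def symGinvRegion {n : ℕ} (A : Matrix (Fin n) (Fin n) ℝ) :
    Set (Matrix (Fin n) (Fin n) ℝ × Matrix (Fin n) (Fin n) ℝ) :=
  {p | p ∈ ginvRegion A ∧ (p.1 - p.2).transpose = p.1 - p.2}

/-- The LP objective `⟨J, H⁺⟩ + ⟨J, H⁻⟩`, with `J` the all-ones matrix. -/
def lpCost {n : ℕ} (p : Matrix (Fin n) (Fin n) ℝ × Matrix (Fin n) (Fin n) ℝ) : ℝ :=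
  (∑ i, ∑ j, p.1 i j) + ∑ i, ∑ j, p.2 i j

/-- `p` is an optimal solution of the LP `min {lpCost q : q ∈ F}`. -/
def IsLPOptimal {n : ℕ} (F : Set (Matrix (Fin n) (Fin n) ℝ × Matrix (Fin n) (Fin n) ℝ))
    (p : Matrix (Fin n) (Fin n) ℝ × Matrix (Fin n) (Fin n) ℝ) : Prop :=
  p ∈ F ∧ ∀ q ∈ F, lpCost p ≤ lpCost q

/-- The number `‖H‖₀` of nonzero entries of `H`. -/
noncomputable def nnzEntries {n : ℕ} (H : Matrix (Fin n) (Fin n) ℝ) : ℕ :=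
  {ij : Fin n × Fin n | H ij.1 ij.2 ≠ 0}.ncard

/-! Upper bounds. Factor `A = B * C` through dimension `r`. A perturbation `D` of `H` with `C * D *
B = 0` keeps `A H A = A`, and this is `r²` linear conditions on `D`. If `H` has more than `r²`
nonzeros, some `D ≠ 0` supported on them satisfies all conditions, so the LP point can move both
ways and is not extreme (`mem_extremePoints_perturb`). In the symmetric problem the conditions lie
in the symmetric `r × r` matrices, of dimension `(r² + r)/2`, while symmetric matrices on a
symmetric support `S` have dimension at least `|S|/2`; hence `r² + r`.

Sharpness. For `A = Cᵀ M C` with `C` right invertible and `M N = 1`, the constraint reads `C H Cᵀ =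
N`. LP duality (`isLPOptimal_of_dual`) asks for a matrix `W` with entries in `[-1, 1]`, orthogonal
to the kernel of `D ↦ C D Cᵀ`, with `H` supported where `|W| = 1` and signed like `W`; the optimum
is unique if no nonzero kernel element lives on `|W| = 1`. Without symmetry, `C` can be a coordinate
projection.

In the symmetric problem only `W` has to be found: given `r² + r` entries of modulus one and the
uniqueness property, a dimension count produces `H` and then `A`
(`exists_sharp_symGinvRegion_of_certificate`). Orthogonality holds when `W` is symmetric and
annihilates `ker C`, here spanned by `(1, 0, x)`, `(0, 1, y)` and padding coordinates;
`IsKernelCertificate` records such data. Explicit certificates serve `r = 3, …, 7`, and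
`IsKernelCertificate.exists_extend` passes from `r` to `r + 4`, starting from `4, 5, 6, 7`. -/

open Matrix

/-! ### Upper bounds: perturbing extreme points -/

/-- A matrix of rank `r` factors through `Fin r`. -/
theorem exists_mul_eq_of_rank_eq {n r : ℕ} (A : Matrix (Fin n) (Fin n) ℝ) (h : A.rank = r) :
    ∃ (B : Matrix (Fin n) (Fin r) ℝ) (C : Matrix (Fin r) (Fin n) ℝ), A = B * C := by
  let b := Module.finBasisOfFinrankEq ℝ (LinearMap.range A.mulVecLin) h
  have hmem : ∀ j, A.col j ∈ LinearMap.range A.mulVecLin := fun j =>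
    ⟨Pi.single j 1, by simp⟩
  refine ⟨.of fun i k => (b k : Fin n → ℝ) i, .of fun k j => b.repr ⟨A.col j, hmem j⟩ k, ?_⟩
  ext i j
  have := congrArg (fun v : LinearMap.range A.mulVecLin => (v : Fin n → ℝ) i)
    (b.sum_repr ⟨A.col j, hmem j⟩)
  simp only [Submodule.coe_sum, Finset.sum_apply, Submodule.coe_smul, Pi.smul_apply,
    smul_eq_mul, col_apply] at this
  rw [← this, mul_apply]
  exact Finset.sum_congr rfl fun k _ => mul_comm _ _

/-- Split `D` by the sign of `H`: where `H > 0` move `H⁺`, where `H < 0` move `H⁻`. The part being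
moved is at least `|H| > 0` there, so small steps in both directions stay nonnegative, and
extremality forces the direction to vanish. -/
theorem mem_extremePoints_perturb {n : ℕ}
    {F : Set (Matrix (Fin n) (Fin n) ℝ × Matrix (Fin n) (Fin n) ℝ)}
    {p : Matrix (Fin n) (Fin n) ℝ × Matrix (Fin n) (Fin n) ℝ} (hp : p ∈ F.extremePoints ℝ)
    (hpos : (∀ i j, 0 ≤ p.1 i j) ∧ ∀ i j, 0 ≤ p.2 i j)
    (D : Matrix (Fin n) (Fin n) ℝ) (hD : ∀ i j, (p.1 - p.2) i j = 0 → D i j = 0)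
    (hF : ∀ (q : Matrix (Fin n) (Fin n) ℝ × Matrix (Fin n) (Fin n) ℝ) (t : ℝ),
      (∀ i j, 0 ≤ q.1 i j) → (∀ i j, 0 ≤ q.2 i j) →
      q.1 - q.2 = p.1 - p.2 + t • D → q ∈ F) : D = 0 := by
  set H := p.1 - p.2 with hH
  have hHij : ∀ i j, H i j = p.1 i j - p.2 i j := fun i j => rfl
  obtain ⟨e, he0, he⟩ : ∃ e : ℝ, 0 < e ∧ ∀ i j, H i j ≠ 0 → e * |D i j| < |H i j| := by
    have h1 : ∀ᶠ e : ℝ in nhdsWithin 0 (Set.Ioi 0),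
        ∀ i j, H i j ≠ 0 → e * |D i j| < |H i j| := by
      refine Filter.eventually_all.2 fun i => Filter.eventually_all.2 fun j => ?_
      by_cases h : H i j = 0
      · simp [h]
      · have : Filter.Tendsto (fun e : ℝ => e * |D i j|) (nhdsWithin 0 (Set.Ioi 0))
            (nhds (0 * |D i j|)) :=
          ((continuous_id.mul continuous_const).tendsto _).mono_left nhdsWithin_le_nhds
        rw [zero_mul] at this
        filter_upwards [this.eventually_lt_const (abs_pos.2 h)] with e he _ using he
    exact ((eventually_mem_nhdsWithin).and h1).exists
  let d : Matrix (Fin n) (Fin n) ℝ × Matrix (Fin n) (Fin n) ℝ :=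
    (.of fun i j => if 0 < H i j then D i j else 0, .of fun i j => if H i j < 0 then -D i j else 0)
  have hd : d.1 - d.2 = D := by
    ext i j
    simp only [d, Matrix.sub_apply, of_apply]
    rcases lt_trichotomy (H i j) 0 with h | h | h
    · simp [h, h.not_gt]
    · simp [h, hD i j h]
    · simp [h, h.not_gt]
  have key : ∀ t : ℝ, |t| = e → p + t • d ∈ F := by
    intro t ht
    have hb : ∀ i j, H i j ≠ 0 → |t * D i j| < |H i j| := fun i j h => by
      rw [abs_mul, ht]; exact he i j h
    refine hF _ t (fun i j => ?_) (fun i j => ?_) ?_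
    · have h1 := hpos.1 i j
      have h2 := hpos.2 i j
      simp only [d, Prod.fst_add, Prod.smul_fst, Matrix.add_apply, Matrix.smul_apply, of_apply, smul_eq_mul]
      split_ifs with h
      · have h3 := hb i j h.ne'
        rw [abs_of_pos h, hHij] at h3
        linarith [neg_abs_le (t * D i j)]
      · linarith
    · have h1 := hpos.1 i j
      have h2 := hpos.2 i j
      simp only [d, Prod.snd_add, Prod.smul_snd, Matrix.add_apply, Matrix.smul_apply, of_apply, smul_eq_mul]
      split_ifs with h
      · have h3 := hb i j h.ne
        rw [abs_of_neg h, hHij] at h3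
        linarith [le_abs_self (t * D i j)]
      · linarith
    · simp only [Prod.fst_add, Prod.smul_fst, Prod.snd_add, Prod.smul_snd]
      rw [← hd, hH, smul_sub]; abel
  have hseg : p ∈ openSegment ℝ (p + e • d) (p + (-e) • d) :=
    ⟨1/2, 1/2, by norm_num, by norm_num, by norm_num, by module⟩
  have := hp.2 (key e (abs_of_pos he0)) (key (-e) (by rw [abs_neg, abs_of_pos he0])) hseg
  have h0 : d = 0 := by
    have : e • d = 0 := by simpa using this
    exact (smul_eq_zero.1 this).resolve_left he0.ne'
  rw [← hd, h0]; simp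

/-- A linear map kills a nonzero matrix supported on `S` if `S` is larger than its target's
dimension. -/
theorem exists_ne_zero_supported {n : ℕ} {V : Type*} [AddCommGroup V] [Module ℝ V]
    [FiniteDimensional ℝ V] (f : Matrix (Fin n) (Fin n) ℝ →ₗ[ℝ] V)
    (S : Finset (Fin n × Fin n)) (h : Module.finrank ℝ V < S.card) :
    ∃ D : Matrix (Fin n) (Fin n) ℝ, D ≠ 0 ∧ (∀ i j, (i, j) ∉ S → D i j = 0) ∧ f D = 0 := by
  let L : (S → ℝ) →ₗ[ℝ] Matrix (Fin n) (Fin n) ℝ :=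
    { toFun := fun g => .of fun i j => if h : (i, j) ∈ S then g ⟨_, h⟩ else 0
      map_add' := fun g g' => by ext i j; simp only [of_apply, Matrix.add_apply]; split_ifs <;> simp_all
      map_smul' := fun c g => by ext i j; simp only [of_apply, Matrix.smul_apply]; split_ifs <;> simp_all }
  have hlt : Module.finrank ℝ V < Module.finrank ℝ (S → ℝ) := by simpa using h
  obtain ⟨g, hg, hg0⟩ := Submodule.exists_mem_ne_zero_of_ne_bot
    (LinearMap.ker_ne_bot_of_finrank_lt (f := f ∘ₗ L) hlt)
  refine ⟨L g, fun h0 => hg0 ?_, fun i j hij => by simp [L, hij], hg⟩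
  ext ⟨⟨i, j⟩, hs⟩
  simpa [L, hs] using congrFun (congrFun h0 i) j

/-- The symmetric matrix with prescribed upper triangle, as a linear map. -/
def symmExtend {n : ℕ} (T : Finset (Fin n × Fin n)) :
    (T → ℝ) →ₗ[ℝ] Matrix (Fin n) (Fin n) ℝ where
  toFun g := .of fun i j => if h : (min i j, max i j) ∈ T then g ⟨_, h⟩ else 0
  map_add' g g' := by ext i j; simp only [of_apply, Matrix.add_apply]; split_ifs <;> simp_all
  map_smul' c g := by ext i j; simp only [of_apply, Matrix.smul_apply]; split_ifs <;> simp_all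

theorem symmExtend_isSymm {n : ℕ} (T : Finset (Fin n × Fin n)) (g : T → ℝ) :
    (symmExtend T g).IsSymm := by
  ext i j
  simp only [symmExtend, LinearMap.coe_mk, AddHom.coe_mk, transpose_apply, of_apply,
    min_comm j i, max_comm j i]

theorem card_le_two_mul_card_filter_le {n : ℕ} (S : Finset (Fin n × Fin n))
    (hS : ∀ i j, (i, j) ∈ S → (j, i) ∈ S) :
    S.card ≤ 2 * (S.filter fun z => z.1 ≤ z.2).card := by
  set T := S.filter fun z => z.1 ≤ z.2
  have : S ⊆ T ∪ T.image Prod.swap := by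
    rintro ⟨i, j⟩ h
    rcases le_total i j with h' | h'
    · exact Finset.mem_union_left _ (Finset.mem_filter.2 ⟨h, h'⟩)
    · exact Finset.mem_union_right _ (Finset.mem_image.2
        ⟨(j, i), Finset.mem_filter.2 ⟨hS _ _ h, h'⟩, rfl⟩)
  classical
  calc S.card ≤ (T ∪ T.image Prod.swap).card := Finset.card_le_card this
    _ ≤ T.card + (T.image Prod.swap).card := Finset.card_union_le _ _
    _ ≤ T.card + T.card := by exact Nat.add_le_add_left Finset.card_image_le _
    _ = 2 * T.card := by ring

/-- The space of symmetric matrices. -/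
def symmSubmodule (κ : Type*) : Submodule ℝ (Matrix κ κ ℝ) where
  carrier := {M | M.IsSymm}
  add_mem' h h' := IsSymm.add h h'
  zero_mem' := isSymm_zero
  smul_mem' c _ h := IsSymm.smul h c

/-- A symmetric matrix is a function on unordered pairs, and there are `(k + 1).choose 2` of these.
-/
theorem two_mul_finrank_symmSubmodule_le (κ : Type*) [Fintype κ] [DecidableEq κ] :
    2 * Module.finrank ℝ (symmSubmodule κ) ≤ Fintype.card κ ^ 2 + Fintype.card κ := by
  let L : (Sym2 κ → ℝ) →ₗ[ℝ] Matrix κ κ ℝ :=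
    { toFun := fun g => .of fun i j => g s(i, j)
      map_add' := fun _ _ => rfl
      map_smul' := fun _ _ => rfl }
  have hle : symmSubmodule κ ≤ LinearMap.range L := by
    intro M hM
    refine ⟨Sym2.lift ⟨fun i j => M i j, fun i j => IsSymm.apply hM j i⟩, ?_⟩
    ext i j; rfl
  have h1 := (Submodule.finrank_mono hle).trans (LinearMap.finrank_range_le L)
  rw [Module.finrank_fintype_fun_eq_card, Sym2.card, Nat.choose_two_right] at h1
  have h2 := Nat.div_mul_le_self ((Fintype.card κ + 1) * (Fintype.card κ + 1 - 1)) 2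
  rw [Nat.add_sub_cancel] at h1 h2
  nlinarith

/-- The symmetric matrices supported on a symmetric set `S` of positions form a space of dimension
at least `|S| / 2`; stated for a linear map into a space of smaller dimension. -/
theorem exists_ne_zero_symm_supported {n : ℕ} {V : Type*} [AddCommGroup V] [Module ℝ V]
    [FiniteDimensional ℝ V] (X : Type*) [AddCommGroup X] [Module ℝ X] [FiniteDimensional ℝ X]
    (f : Matrix (Fin n) (Fin n) ℝ × X →ₗ[ℝ] V) (K : Submodule ℝ V)
    (hf : ∀ D x, D.IsSymm → f (D, x) ∈ K)
    (S : Finset (Fin n × Fin n)) (hS : ∀ i j, (i, j) ∈ S → (j, i) ∈ S)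
    (h : 2 * Module.finrank ℝ K < S.card + 2 * Module.finrank ℝ X) :
    ∃ (D : Matrix (Fin n) (Fin n) ℝ) (x : X), (D, x) ≠ 0 ∧ D.IsSymm ∧
      (∀ i j, (i, j) ∉ S → D i j = 0) ∧ f (D, x) = 0 := by
  set T := S.filter fun z => z.1 ≤ z.2 with hT
  have hcard : S.card ≤ 2 * T.card := card_le_two_mul_card_filter_le S hS
  -- The entries on the upper triangle `T` of `S` are free parameters, at least `|S| / 2` of them;
  -- `X` adds further scalar unknowns.
  let L : ((T → ℝ) × X) →ₗ[ℝ] K :=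
    LinearMap.codRestrict K (f ∘ₗ LinearMap.prodMap (symmExtend T) LinearMap.id)
      fun z => hf _ _ (symmExtend_isSymm _ _)
  have hlt : Module.finrank ℝ K < Module.finrank ℝ ((T → ℝ) × X) := by
    rw [Module.finrank_prod, Module.finrank_fintype_fun_eq_card, Fintype.card_coe]
    omega
  obtain ⟨⟨g, x⟩, hg, hg0⟩ := Submodule.exists_mem_ne_zero_of_ne_bot
    (LinearMap.ker_ne_bot_of_finrank_lt (f := L) hlt)
  refine ⟨symmExtend T g, x, fun h0 => hg0 ?_, symmExtend_isSymm _ _, fun i j hij => ?_, ?_⟩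
  · rw [Prod.mk_eq_zero] at h0 ⊢
    refine ⟨?_, h0.2⟩
    ext ⟨⟨i, j⟩, hs⟩
    have hle : i ≤ j := (Finset.mem_filter.1 hs).2
    have := congrFun (congrFun h0.1 i) j
    simpa [symmExtend, hle, hs] using this
  · have : (min i j, max i j) ∉ T := fun hm => hij <| by
      have hm := (Finset.mem_filter.1 hm).1
      rcases le_total i j with h' | h'
      · simpa [h'] using hm
      · exact hS _ _ (by simpa [h'] using hm)
    simp [symmExtend, this]
  · exact congrArg Subtype.val (LinearMap.mem_ker.1 hg)

theorem nnzEntries_eq_card {n : ℕ} (H : Matrix (Fin n) (Fin n) ℝ)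
    [DecidablePred fun ij : Fin n × Fin n => H ij.1 ij.2 ≠ 0] :
    nnzEntries H = (Finset.univ.filter fun ij : Fin n × Fin n => H ij.1 ij.2 ≠ 0).card := by
  rw [nnzEntries, ← Set.ncard_coe_finset]; simp

/-- Compression `D ↦ C D B` as a linear map. -/
def compress {m n k : Type*} [Fintype n] (C : Matrix m n ℝ) (B : Matrix n k ℝ) :
    Matrix n n ℝ →ₗ[ℝ] Matrix m k ℝ where
  toFun D := C * D * B
  map_add' D D' := by rw [Matrix.mul_add, Matrix.add_mul]
  map_smul' c D := by simp

theorem mul_mul_eq_zero_of_compress {n r : ℕ} {A : Matrix (Fin n) (Fin n) ℝ}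
    {B : Matrix (Fin n) (Fin r) ℝ} {C : Matrix (Fin r) (Fin n) ℝ} (hA : A = B * C)
    {D : Matrix (Fin n) (Fin n) ℝ} (hD : C * D * B = 0) : A * D * A = 0 := by
  have : A * D * A = B * (C * D * B) * C := by rw [hA]; simp only [Matrix.mul_assoc]
  rw [this, hD]; simp

theorem nnzEntries_le_of_mem_extremePoints_ginvRegion {n r : ℕ} (A : Matrix (Fin n) (Fin n) ℝ)
    (hr : A.rank = r) (p) (hp : p ∈ (ginvRegion A).extremePoints ℝ) :
    nnzEntries (p.1 - p.2) ≤ r ^ 2 := by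
  classical
  obtain ⟨B, C, hA⟩ := exists_mul_eq_of_rank_eq A hr
  rw [nnzEntries_eq_card]
  by_contra! hlt
  obtain ⟨D, hD0, hDS, hD⟩ := exists_ne_zero_supported (compress C B) _
    (show Module.finrank ℝ (Matrix (Fin r) (Fin r) ℝ) < _ by
      simpa [Module.finrank_matrix, sq] using hlt)
  have hADA := mul_mul_eq_zero_of_compress hA hD
  refine hD0 (mem_extremePoints_perturb hp hp.1.2 D (fun i j h => hDS i j fun hm => (Finset.mem_filter.1 hm).2 h)
    fun q t h1 h2 hq => ⟨?_, h1, h2⟩)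
  rw [hq, Matrix.mul_add, Matrix.add_mul, hp.1.1]
  simp [hADA]

theorem nnzEntries_le_of_mem_extremePoints_symGinvRegion {n r : ℕ}
    (A : Matrix (Fin n) (Fin n) ℝ) (hsymm : A.IsSymm)
    (hr : A.rank = r) (p) (hp : p ∈ (symGinvRegion A).extremePoints ℝ) :
    nnzEntries (p.1 - p.2) ≤ r ^ 2 + r := by
  classical
  obtain ⟨B, C, hA⟩ := exists_mul_eq_of_rank_eq A hr
  have hA' : A = Cᵀ * Bᵀ := by rw [← transpose_mul, ← hA, hsymm.eq]
  have hH : ∀ i j, (p.1 - p.2) i j = (p.1 - p.2) j i := fun i j =>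
    congrFun (congrFun hp.1.2 j) i
  rw [nnzEntries_eq_card]
  by_contra! hlt
  have hdim := two_mul_finrank_symmSubmodule_le (Fin r)
  rw [Fintype.card_fin] at hdim
  -- Compressing as `Bᵀ * D * B` rather than `C * D * B` keeps the result symmetric; this uses `A =
  -- B * C = Cᵀ * Bᵀ`. No extra unknown is needed, hence `PUnit`.
  obtain ⟨D, x, hD0, hDs, hDS, hD⟩ := exists_ne_zero_symm_supported PUnit
    (compress Bᵀ B ∘ₗ LinearMap.fst ℝ _ PUnit) (symmSubmodule (Fin r))
    (fun D x hD => by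
      show (Bᵀ * D * B).IsSymm
      simp only [IsSymm, transpose_mul, transpose_transpose, hD.eq, Matrix.mul_assoc])
    (Finset.univ.filter fun ij : Fin n × Fin n => (p.1 - p.2) ij.1 ij.2 ≠ 0) (fun i j hij => by
      simp only [Finset.mem_filter, Finset.mem_univ, true_and] at hij ⊢
      rwa [hH j i]) (by
      exact lt_of_le_of_lt hdim (Nat.lt_add_right _ hlt))
  have hBDB : Bᵀ * D * B = 0 := hD
  have hADA : A * D * A = 0 := by
    have : A * D * A = Cᵀ * (Bᵀ * D * B) * C := by
      calc A * D * A = (Cᵀ * Bᵀ) * D * (B * C) := by rw [← hA, ← hA']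
        _ = _ := by simp only [Matrix.mul_assoc]
    rw [this, hBDB]; simp
  refine hD0 (Prod.mk_eq_zero.2 ⟨mem_extremePoints_perturb hp hp.1.1.2 D
    (fun i j h => hDS i j fun hm => (Finset.mem_filter.1 hm).2 h) fun q t h1 h2 hq => ⟨⟨?_, h1, h2⟩, ?_⟩, rfl⟩)
  · rw [hq, Matrix.mul_add, Matrix.add_mul, hp.1.1.1]
    simp [hADA]
  · rw [hq, transpose_add, hp.1.2, transpose_smul, hDs.eq]

/-! ### LP duality and dual certificates -/

/-- Complementary slackness: a dual matrix `W` certifies that `p` is the unique optimum. -/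
theorem isLPOptimal_of_dual {n : ℕ}
    {F : Set (Matrix (Fin n) (Fin n) ℝ × Matrix (Fin n) (Fin n) ℝ)}
    {p : Matrix (Fin n) (Fin n) ℝ × Matrix (Fin n) (Fin n) ℝ} (hp : p ∈ F)
    (hpos : ∀ q ∈ F, (∀ i j, 0 ≤ q.1 i j) ∧ ∀ i j, 0 ≤ q.2 i j)
    (W : Matrix (Fin n) (Fin n) ℝ) (hW : ∀ i j, |W i j| ≤ 1)
    (hdual : ∀ q ∈ F, ∑ i, ∑ j, W i j * (q.1 - q.2) i j = ∑ i, ∑ j, W i j * (p.1 - p.2) i j)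
    (hcs : ∀ i j, W i j * (p.1 - p.2) i j = p.1 i j + p.2 i j)
    (huniq : ∀ q ∈ F, (∀ i j, |W i j| < 1 → (q.1 - q.2) i j = 0) → q.1 - q.2 = p.1 - p.2) :
    p ∈ F.extremePoints ℝ ∧ IsLPOptimal F p ∧ ∀ q, IsLPOptimal F q → q = p := by
  have hterm : ∀ q ∈ F, ∀ i j, W i j * (q.1 - q.2) i j ≤ q.1 i j + q.2 i j := by
    intro q hq i j
    have h1 := (hpos q hq).1 i j
    have h2 := (hpos q hq).2 i j
    have h3 := abs_le.1 (hW i j)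
    rw [Matrix.sub_apply]
    nlinarith [mul_nonneg (sub_nonneg.2 h3.2) h1, mul_nonneg (sub_nonneg.2 h3.1) h2]
  have hcost : ∀ q : Matrix (Fin n) (Fin n) ℝ × Matrix (Fin n) (Fin n) ℝ,
      lpCost q = ∑ i, ∑ j, (q.1 i j + q.2 i j) := by
    intro q; simp only [lpCost, Finset.sum_add_distrib]
  have hpc : lpCost p = ∑ i, ∑ j, W i j * (p.1 - p.2) i j := by
    rw [hcost]; simp only [hcs]
  have hopt : ∀ q ∈ F, lpCost p ≤ lpCost q := by
    intro q hq
    rw [hpc, ← hdual q hq, hcost]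
    exact Finset.sum_le_sum fun i _ => Finset.sum_le_sum fun j _ => hterm q hq i j
  have hun : ∀ q ∈ F, lpCost q ≤ lpCost p → q = p := by
    intro q hq hle
    rw [hpc, ← hdual q hq, hcost] at hle
    -- The termwise inequalities `hterm` sum to an equality, so each one is tight; where `|W| < 1`
    -- tightness kills both parts of `q`.
    have heq : ∀ i j, W i j * (q.1 - q.2) i j = q.1 i j + q.2 i j := by
      have h0 := le_antisymm (Finset.sum_le_sum fun i _ =>
        Finset.sum_le_sum fun j (_ : j ∈ Finset.univ) => hterm q hq i j) hle
      intro i j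
      have h1 := (Finset.sum_eq_sum_iff_of_le (fun i _ =>
        Finset.sum_le_sum fun j (_ : j ∈ Finset.univ) => hterm q hq i j)).1 h0 i
          (Finset.mem_univ _)
      exact (Finset.sum_eq_sum_iff_of_le fun j _ => hterm q hq i j).1 h1 j (Finset.mem_univ _)
    have hdiff := huniq q hq fun i j hlt => by
      have h1 := (hpos q hq).1 i j
      have h2 := (hpos q hq).2 i j
      have h3 := abs_lt.1 hlt
      have h4 := heq i j
      rw [Matrix.sub_apply] at h4 ⊢
      have h5 : q.1 i j = 0 := by
        by_contra h
        nlinarith [mul_pos (sub_pos.2 h3.2) (lt_of_le_of_ne h1 (Ne.symm h)),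
          mul_nonneg (sub_pos.2 h3.1).le h2]
      have h6 : q.2 i j = 0 := by
        by_contra h
        nlinarith [mul_pos (sub_pos.2 h3.1) (lt_of_le_of_ne h2 (Ne.symm h)),
          mul_nonneg (sub_pos.2 h3.2).le h1]
      rw [h5, h6, sub_zero]
    have hij : ∀ i j, q.1 i j - q.2 i j = p.1 i j - p.2 i j := fun i j =>
      congrFun (congrFun hdiff i) j
    have hij' : ∀ i j, q.1 i j + q.2 i j = p.1 i j + p.2 i j := fun i j => by
      rw [← heq, hdiff, hcs]
    refine Prod.ext ?_ ?_ <;> ext i j <;> linarith [hij i j, hij' i j]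
  -- Extremality follows from uniqueness: if `p` is a proper convex combination of `y` and `z`, then
  -- `z` costs at least as much as `p`, so `y` costs at most as much and equals `p`.
  refine ⟨⟨hp, fun y hy z hz hyz => ?_⟩, ⟨hp, hopt⟩,
    fun q hq => hun q hq.1 (hq.2 p hp)⟩
  obtain ⟨a, b, ha, hb, hab, rfl⟩ := hyz
  refine hun y hy ?_
  have hlin : lpCost (a • y + b • z) = a * lpCost y + b * lpCost z := by
    simp only [hcost, Prod.fst_add, Prod.snd_add, Prod.smul_fst, Prod.smul_snd, Matrix.add_apply,
      Matrix.smul_apply, smul_eq_mul, Finset.mul_sum, ← Finset.sum_add_distrib]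
    exact Finset.sum_congr rfl fun i _ => Finset.sum_congr rfl fun j _ => by ring
  have h1 := hopt z hz
  have h2 : b * lpCost (a • y + b • z) ≤ b * lpCost z := mul_le_mul_of_nonneg_left h1 hb.le
  have h3 : a * lpCost y ≤ a * lpCost (a • y + b • z) := by
    have : lpCost (a • y + b • z) = a * lpCost (a • y + b • z) + b * lpCost (a • y + b • z) := by
      rw [← add_mul, hab, one_mul]
    linarith
  exact le_of_mul_le_mul_left h3 ha

/-- The pair of positive and negative parts of a matrix. -/
def posNegPart {n : ℕ} (H : Matrix (Fin n) (Fin n) ℝ) :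
    Matrix (Fin n) (Fin n) ℝ × Matrix (Fin n) (Fin n) ℝ :=
  (.of fun i j => max (H i j) 0, .of fun i j => max (-H i j) 0)

theorem posNegPart_sub {n : ℕ} (H : Matrix (Fin n) (Fin n) ℝ) :
    (posNegPart H).1 - (posNegPart H).2 = H := by
  ext i j
  simp only [posNegPart, Matrix.sub_apply, of_apply]
  rcases le_total 0 (H i j) with h | h
  · rw [max_eq_left h, max_eq_right (by linarith), sub_zero]
  · rw [max_eq_right h, max_eq_left (by linarith)]; ring

theorem posNegPart_add_apply {n : ℕ} (H : Matrix (Fin n) (Fin n) ℝ) (i j) :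
    (posNegPart H).1 i j + (posNegPart H).2 i j = |H i j| := by
  simp only [posNegPart, of_apply]
  rcases le_total 0 (H i j) with h | h
  · rw [max_eq_left h, max_eq_right (by linarith), abs_of_nonneg h, add_zero]
  · rw [max_eq_right h, max_eq_left (by linarith), abs_of_nonpos h, zero_add]

section congruence
variable {n : ℕ} {κ : Type*} [Fintype κ] [DecidableEq κ] {C : Matrix κ (Fin n) ℝ}
  {R : Matrix (Fin n) κ ℝ} {M N : Matrix κ κ ℝ}

/-- The full-rank factors cancel: multiplying by `N * Rᵀ` on the left and `R * N` on the right
removes `Cᵀ * M` and `M * C`. -/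
theorem compress_congruence_eq_iff (hCR : C * R = 1) (hMN : M * N = 1)
    (H : Matrix (Fin n) (Fin n) ℝ) :
    (Cᵀ * M * C) * H * (Cᵀ * M * C) = Cᵀ * M * C ↔ C * H * Cᵀ = N := by
  have hNM : N * M = 1 := mul_eq_one_comm.1 hMN
  have hRC : Rᵀ * Cᵀ = 1 := by rw [← transpose_mul, hCR, transpose_one]
  constructor
  · intro h
    have h1 := congrArg (fun X => N * (Rᵀ * X * R) * N) h
    have e1 : N * (Rᵀ * (Cᵀ * M * C * H * (Cᵀ * M * C)) * R) * N = C * H * Cᵀ := by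
      calc _ = (N * ((Rᵀ * Cᵀ) * M)) * (C * H * Cᵀ) * ((M * (C * R)) * N) := by
            simp only [Matrix.mul_assoc]
        _ = _ := by
          rw [hRC, hCR, Matrix.one_mul, Matrix.mul_one, hNM, hMN, Matrix.one_mul, Matrix.mul_one]
    have e2 : N * (Rᵀ * (Cᵀ * M * C) * R) * N = N := by
      calc _ = (N * ((Rᵀ * Cᵀ) * M)) * (C * R) * N := by simp only [Matrix.mul_assoc]
        _ = _ := by rw [hRC, hCR, Matrix.one_mul, hNM, Matrix.one_mul, Matrix.one_mul]
    exact e1.symm.trans (h1.trans e2)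
  · intro h
    calc _ = Cᵀ * M * (C * H * Cᵀ) * M * C := by simp only [Matrix.mul_assoc]
      _ = Cᵀ * (M * N) * M * C := by rw [h]; simp only [Matrix.mul_assoc]
      _ = _ := by rw [hMN, Matrix.mul_one]

theorem rank_congruence (hCR : C * R = 1) (hMN : M * N = 1) :
    (Cᵀ * M * C).rank = Fintype.card κ := by
  have hNM : N * M = 1 := mul_eq_one_comm.1 hMN
  have hRC : Rᵀ * Cᵀ = 1 := by rw [← transpose_mul, hCR, transpose_one]
  refine le_antisymm ((rank_mul_le_right _ _).trans (rank_le_card_height _)) ?_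
  have e2 : N * Rᵀ * (Cᵀ * M * C) * R = 1 := by
    calc _ = N * ((Rᵀ * Cᵀ) * M) * (C * R) := by simp only [Matrix.mul_assoc]
      _ = _ := by rw [hRC, hCR, Matrix.one_mul, hNM, Matrix.one_mul]
  calc Fintype.card κ = (1 : Matrix κ κ ℝ).rank := rank_one.symm
    _ = (N * Rᵀ * (Cᵀ * M * C) * R).rank := by rw [e2]
    _ ≤ (N * Rᵀ * (Cᵀ * M * C)).rank := rank_mul_le_left _ _
    _ ≤ _ := rank_mul_le_right _ _

/-- Sharpness from a dual certificate `W`, uniformly for the two linear programs. -/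
theorem exists_unique_optimal_of_certificate (hCR : C * R = 1) (hMN : M * N = 1)
    (F : Set (Matrix (Fin n) (Fin n) ℝ × Matrix (Fin n) (Fin n) ℝ))
    (hF : F ⊆ ginvRegion (Cᵀ * M * C))
    (W H : Matrix (Fin n) (Fin n) ℝ) (hW : ∀ i j, |W i j| ≤ 1)
    (hHN : C * H * Cᵀ = N)
    (hHF : posNegPart H ∈ ginvRegion (Cᵀ * M * C) → posNegPart H ∈ F)
    (hWH : ∀ i j, W i j * H i j = |H i j|)
    (hH0 : ∀ i j, |W i j| < 1 → H i j = 0)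
    (hdual : ∀ q ∈ F, C * (q.1 - q.2 - H) * Cᵀ = 0 →
      ∑ i, ∑ j, W i j * (q.1 - q.2 - H) i j = 0)
    (huniq : ∀ q ∈ F, C * (q.1 - q.2 - H) * Cᵀ = 0 →
      (∀ i j, |W i j| < 1 → (q.1 - q.2 - H) i j = 0) → q.1 - q.2 - H = 0) :
    ∃ p ∈ F.extremePoints ℝ, IsLPOptimal F p ∧ (∀ q, IsLPOptimal F q → q = p) ∧
      p.1 - p.2 = H := by
  have hmem : posNegPart H ∈ F := hHF ⟨by
    rw [posNegPart_sub]; exact (compress_congruence_eq_iff hCR hMN H).2 hHN,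
    fun i j => le_max_right _ _, fun i j => le_max_right _ _⟩
  have hker : ∀ q ∈ F, C * (q.1 - q.2 - H) * Cᵀ = 0 := fun q hq => by
    rw [Matrix.mul_sub, Matrix.sub_mul, hHN,
      (compress_congruence_eq_iff hCR hMN _).1 (hF hq).1, sub_self]
  obtain ⟨h1, h2, h3⟩ := isLPOptimal_of_dual hmem (fun q hq => (hF hq).2) W hW
    (fun q hq => by
      have := hdual q hq (hker q hq)
      simp only [Matrix.sub_apply _ H, mul_sub, Finset.sum_sub_distrib] at this
      rw [posNegPart_sub]
      exact sub_eq_zero.1 this)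
    (fun i j => by rw [posNegPart_add_apply, posNegPart_sub, hWH])
    (fun q hq hq0 => by
      rw [posNegPart_sub]
      refine sub_eq_zero.1 (huniq q hq (hker q hq) fun i j hlt => ?_)
      rw [Matrix.sub_apply, hq0 i j hlt, hH0 i j hlt, sub_zero])
  exact ⟨_, h1, h2, h3, posNegPart_sub H⟩

end congruence

/-! ### Sharpness without symmetry -/

/-- With `C` selecting the first `r` coordinates, the constraint fixes the leading `r × r` block of
`H` to be `N` and leaves all other entries free, so the unique minimum sets these to zero. It
remains to take `N` invertible, symmetric and without zero entries. -/
theorem exists_sharp_ginvRegion {n r : ℕ} (hrn : r ≤ n) :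
    ∃ A : Matrix (Fin n) (Fin n) ℝ, A.IsSymm ∧ A.rank = r ∧
      ∃ p ∈ (ginvRegion A).extremePoints ℝ, IsLPOptimal (ginvRegion A) p ∧
        (∀ q, IsLPOptimal (ginvRegion A) q → q = p) ∧ nnzEntries (p.1 - p.2) = r ^ 2 := by
  classical
  let f : Fin r → Fin n := Fin.castLE hrn
  have hf : Function.Injective f := Fin.castLE_injective hrn
  let C : Matrix (Fin r) (Fin n) ℝ := .of fun i j => if f i = j then 1 else 0
  have hC : ∀ (D : Matrix (Fin n) (Fin n) ℝ) i j, (C * D * Cᵀ) i j = D (f i) (f j) := by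
    intro D i j; simp [C, mul_apply]
  have hCC : C * Cᵀ = 1 := by
    have := hC 1
    rw [Matrix.mul_one] at this
    ext i j
    rw [this, one_apply, one_apply]; simp [hf.eq_iff]
  let J : Matrix (Fin r) (Fin r) ℝ := .of fun _ _ => 1
  have hJJ : J * J = (r : ℝ) • J := by ext i j; simp [J, mul_apply]
  let N : Matrix (Fin r) (Fin r) ℝ := 1 + J
  -- The rank-one update formula for `(1 + J)⁻¹`, using `J * J = r • J`.
  let M : Matrix (Fin r) (Fin r) ℝ := 1 - ((r : ℝ) + 1)⁻¹ • J
  have hr1 : (r : ℝ) + 1 ≠ 0 := by positivity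
  have hMN : M * N = 1 := by
    have : M * N = 1 + (1 - ((r : ℝ) + 1)⁻¹ * (r + 1)) • J := by
      simp only [M, N, Matrix.sub_mul, Matrix.mul_add, Matrix.one_mul, Matrix.mul_one,
        Matrix.smul_mul, hJJ]
      module
    rw [this, inv_mul_cancel₀ hr1]; simp
  have hNpos : ∀ i j, 0 < N i j := fun i j => by
    simp only [N, J, Matrix.add_apply, one_apply, of_apply]; split_ifs <;> norm_num
  let H : Matrix (Fin n) (Fin n) ℝ := Cᵀ * N * C
  have hHN : C * H * Cᵀ = N := by
    calc _ = (C * Cᵀ) * N * (C * Cᵀ) := by simp only [H, Matrix.mul_assoc]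
      _ = N := by rw [hCC, Matrix.one_mul, Matrix.mul_one]
  have hHf : ∀ i j, H (f i) (f j) = N i j := fun i j => by rw [← hC H, hHN]
  have hH0 : ∀ i j, ¬ (i ∈ Set.range f ∧ j ∈ Set.range f) → H i j = 0 := by
    intro i j h
    simp only [H, mul_apply, transpose_apply, C, of_apply]
    refine Finset.sum_eq_zero fun b _ => ?_
    by_cases hj : f b = j
    · have hi : ∀ a, f a ≠ i := fun a ha => h ⟨⟨a, ha⟩, ⟨b, hj⟩⟩
      simp [hi]
    · simp [hj]
  let W : Matrix (Fin n) (Fin n) ℝ := .of fun i j =>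
    if i ∈ Set.range f ∧ j ∈ Set.range f then 1 else 0
  have hsymA : (Cᵀ * M * C).IsSymm := by
    have hM : Mᵀ = M := by
      ext i j
      simp [M, J, one_apply, eq_comm]
    simp only [IsSymm, transpose_mul, transpose_transpose, hM, Matrix.mul_assoc]
  have hDf : ∀ D : Matrix (Fin n) (Fin n) ℝ, C * D * Cᵀ = 0 →
      ∀ i j, i ∈ Set.range f → j ∈ Set.range f → D i j = 0 := by
    rintro D hD _ _ ⟨a, rfl⟩ ⟨b, rfl⟩
    rw [← hC D, hD]; rfl
  obtain ⟨p, hp, hp1, hp2, hp3⟩ := exists_unique_optimal_of_certificate hCC hMN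
    (ginvRegion (Cᵀ * M * C)) le_rfl W H
    (fun i j => by simp only [W, of_apply]; split_ifs <;> simp) hHN id
    (fun i j => by
      by_cases h : i ∈ Set.range f ∧ j ∈ Set.range f
      · have hW : W i j = 1 := by simp only [W, of_apply, if_pos h]
        obtain ⟨⟨a, rfl⟩, ⟨b, rfl⟩⟩ := h
        rw [hW, hHf, one_mul, abs_of_pos (hNpos a b)]
      · simp [hH0 i j h])
    (fun i j h => hH0 i j fun h' => by
      have hW : W i j = 1 := by simp only [W, of_apply, if_pos h']
      rw [hW] at h; simp at h)
    (fun q _ hD => Finset.sum_eq_zero fun i _ => Finset.sum_eq_zero fun j _ => by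
      by_cases h : i ∈ Set.range f ∧ j ∈ Set.range f
      · rw [hDf _ hD i j h.1 h.2, mul_zero]
      · simp only [W, of_apply, if_neg h, zero_mul])
    (fun q _ hD h0 => by
      ext i j
      by_cases h : i ∈ Set.range f ∧ j ∈ Set.range f
      · exact hDf _ hD i j h.1 h.2
      · exact h0 i j (by simp only [W, of_apply, if_neg h]; simp))
  refine ⟨_, hsymA, by simpa using rank_congruence hCC hMN, p, hp, hp1, hp2, ?_⟩
  rw [hp3, nnzEntries]
  have : {ij : Fin n × Fin n | H ij.1 ij.2 ≠ 0} = Set.range (Prod.map f f) := by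
    ext ⟨i, j⟩
    constructor
    · intro h
      by_contra h'
      refine h (hH0 i j fun ⟨⟨a, ha⟩, ⟨b, hb⟩⟩ => h' ⟨(a, b), by simp [ha, hb]⟩)
    · rintro ⟨⟨a, b⟩, hab⟩
      cases hab
      exact (hHf a b).trans_ne (hNpos a b).ne'
  rw [this, ← Set.image_univ, Set.ncard_image_of_injective _ (hf.prodMap hf), Set.ncard_univ]
  simp [sq]

/-! ### Symmetric sharpness: from `W` to a matrix `A` -/

/-- The bad `t` are roots of the characteristic polynomial of `-G`, hence finitely many. -/
theorem exists_small_shift_det_ne_zero {κ : Type*} [Fintype κ] [DecidableEq κ]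
    (G : Matrix κ κ ℝ) {e : ℝ} (he : 0 < e) :
    ∃ t : ℝ, 0 < t ∧ t < e ∧ (G + t • (1 : Matrix κ κ ℝ)).det ≠ 0 := by
  obtain ⟨t, ht, hroot⟩ := (Set.Ioo_infinite he).exists_notMem_finset (-G).charpoly.roots.toFinset
  refine ⟨t, ht.1, ht.2, fun h => hroot ?_⟩
  rw [Multiset.mem_toFinset, Polynomial.mem_roots (charpoly_monic _).ne_zero, Polynomial.IsRoot,
    eval_charpoly, ← h]
  congr 1
  rw [sub_neg_eq_add, add_comm, scalar_apply, smul_one_eq_diagonal]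

/-- By `huniq`, `D ↦ C D Cᵀ` is injective on symmetric matrices supported on `|W| = 1`; by `hcard`
their dimension is at least that of the symmetric target, so every symmetric `N` is attained. The
sign pattern of `W` is a valid `H`, except that its compression may be singular; a small multiple of
a preimage of the identity repairs this without changing signs. -/
theorem exists_sharp_symGinvRegion_of_certificate {n r : ℕ} {κ : Type*} [Fintype κ] [DecidableEq κ]
    (hr : Fintype.card κ = r) {C : Matrix κ (Fin n) ℝ} {R : Matrix (Fin n) κ ℝ} (hCR : C * R = 1)
    (W : Matrix (Fin n) (Fin n) ℝ) (hWs : W.IsSymm) (hW : ∀ i j, |W i j| ≤ 1)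
    (hdual : ∀ D : Matrix (Fin n) (Fin n) ℝ, D.IsSymm → C * D * Cᵀ = 0 →
      ∑ i, ∑ j, W i j * D i j = 0)
    (huniq : ∀ D : Matrix (Fin n) (Fin n) ℝ, D.IsSymm → C * D * Cᵀ = 0 →
      (∀ i j, |W i j| < 1 → D i j = 0) → D = 0)
    (hcard : (Finset.univ.filter fun z : Fin n × Fin n => |W z.1 z.2| = 1).card = r ^ 2 + r) :
    ∃ A : Matrix (Fin n) (Fin n) ℝ, A.IsSymm ∧ A.rank = r ∧
      ∃ p ∈ (symGinvRegion A).extremePoints ℝ, IsLPOptimal (symGinvRegion A) p ∧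
        (∀ q, IsLPOptimal (symGinvRegion A) q → q = p) ∧
        nnzEntries (p.1 - p.2) = r ^ 2 + r := by
  classical
  have hWij : ∀ i j, W i j = W j i := fun i j => hWs.apply j i
  set S := Finset.univ.filter fun z : Fin n × Fin n => |W z.1 z.2| = 1 with hS
  have hmemS : ∀ i j, (i, j) ∈ S ↔ |W i j| = 1 := fun i j => by simp [hS]
  obtain ⟨H₀, hH₀s, hH₀S, hH₀⟩ : ∃ H₀ : Matrix (Fin n) (Fin n) ℝ, H₀.IsSymm ∧
      (∀ i j, |W i j| ≠ 1 → H₀ i j = 0) ∧ C * H₀ * Cᵀ = 1 := by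
    have hdim := two_mul_finrank_symmSubmodule_le κ
    -- Surjectivity onto the identity, by counting: with one extra unknown `x`, the homogeneous
    -- equation `C D Cᵀ = x • 1` has a nonzero solution, and `x = 0` would contradict `huniq`.
    obtain ⟨D, x, hD0, hDs, hDS, hD⟩ := exists_ne_zero_symm_supported ℝ
      (compress C Cᵀ ∘ₗ LinearMap.fst ℝ _ ℝ -
        (LinearMap.toSpanSingleton ℝ (Matrix κ κ ℝ) 1) ∘ₗ LinearMap.snd ℝ _ ℝ) (symmSubmodule κ)
      (fun D x hD => by
        show (C * D * Cᵀ - x • 1).IsSymm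
        simp only [IsSymm, transpose_mul, transpose_transpose, hD.eq, Matrix.mul_assoc,
          transpose_sub, transpose_smul, transpose_one])
      S (fun i j h => by rw [hmemS] at h ⊢; rwa [hWij])
      (by rw [hcard, Module.finrank_self, ← hr]; omega)
    have hD' : C * D * Cᵀ - x • 1 = 0 := hD
    have hx : x ≠ 0 := by
      rintro rfl
      rw [zero_smul, sub_zero] at hD'
      refine hD0 (Prod.mk_eq_zero.2 ⟨huniq D hDs hD' fun i j h => hDS i j ?_, rfl⟩)
      rw [hmemS]; exact h.ne
    refine ⟨x⁻¹ • D, hDs.smul _, fun i j h => ?_, ?_⟩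
    · rw [Matrix.smul_apply, hDS i j (by rwa [hmemS]), smul_zero]
    · rw [Matrix.mul_smul, Matrix.smul_mul, sub_eq_zero.1 hD', smul_smul, inv_mul_cancel₀ hx,
        one_smul]
  let G : Matrix (Fin n) (Fin n) ℝ := .of fun i j => if |W i j| = 1 then W i j else 0
  have hGs : G.IsSymm := by ext i j; simp only [G, transpose_apply, of_apply, hWij j i]
  -- For `t < e` the term `t • H₀` cannot flip an entry `±1` of `G`.
  obtain ⟨e, he0, he⟩ : ∃ e : ℝ, 0 < e ∧ ∀ i j, e * |H₀ i j| < 1 := by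
    have h1 : ∀ᶠ e : ℝ in nhdsWithin 0 (Set.Ioi 0), ∀ i j, e * |H₀ i j| < 1 := by
      refine Filter.eventually_all.2 fun i => Filter.eventually_all.2 fun j => ?_
      have : Filter.Tendsto (fun e : ℝ => e * |H₀ i j|) (nhdsWithin 0 (Set.Ioi 0))
          (nhds (0 * |H₀ i j|)) :=
        ((continuous_id.mul continuous_const).tendsto _).mono_left nhdsWithin_le_nhds
      rw [zero_mul] at this
      exact this.eventually_lt_const one_pos
    exact ((eventually_mem_nhdsWithin).and h1).exists
  obtain ⟨t, ht0, hte, hdet⟩ := exists_small_shift_det_ne_zero (C * G * Cᵀ) he0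
  let H := G + t • H₀
  have hHs : H.IsSymm := hGs.add (hH₀s.smul t)
  set N := C * G * Cᵀ + t • (1 : Matrix κ κ ℝ) with hN
  have hHN : C * H * Cᵀ = N := by
    simp only [H, hN, Matrix.mul_add, Matrix.add_mul, Matrix.mul_smul, Matrix.smul_mul, hH₀]
  have hNs : N.IsSymm := by
    rw [← hHN]
    simp only [IsSymm, transpose_mul, transpose_transpose, hHs.eq, Matrix.mul_assoc]
  have hMN : N⁻¹ * N = 1 := nonsing_inv_mul _ (isUnit_iff_ne_zero.2 hdet)
  have hH1 : ∀ i j, |W i j| = 1 → 0 < W i j * H i j := by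
    intro i j h
    have h1 : W i j * H i j = W i j * W i j + W i j * (t * H₀ i j) := by
      simp only [H, G, Matrix.add_apply, of_apply, if_pos h, Matrix.smul_apply, smul_eq_mul]; ring
    have h2 : W i j * W i j = 1 := by rw [← abs_mul_abs_self, h, one_mul]
    have h3 : |W i j * (t * H₀ i j)| < 1 := by
      rw [abs_mul, h, one_mul, abs_mul, abs_of_pos ht0]
      exact lt_of_le_of_lt (mul_le_mul_of_nonneg_right hte.le (abs_nonneg _)) (he i j)
    rw [h1, h2]; linarith [(abs_lt.1 h3).1]
  have hH0 : ∀ i j, |W i j| ≠ 1 → H i j = 0 := by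
    intro i j h
    simp only [H, G, Matrix.add_apply, of_apply, if_neg h, Matrix.smul_apply, hH₀S i j h, smul_zero,
      add_zero]
  obtain ⟨p, hp, hp1, hp2, hp3⟩ := exists_unique_optimal_of_certificate hCR hMN
    (symGinvRegion (Cᵀ * N⁻¹ * C)) (fun q hq => hq.1) W H hW hHN
    (fun h => ⟨h, by rw [posNegPart_sub]; exact hHs⟩)
    (fun i j => by
      by_cases h : |W i j| = 1
      · rw [← abs_of_pos (hH1 i j h), abs_mul, h, one_mul]
      · rw [hH0 i j h, mul_zero, abs_zero])
    (fun i j h => hH0 i j h.ne)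
    (fun q hq hD => hdual _ (IsSymm.sub hq.2 hHs) hD)
    (fun q hq hD h0 => huniq _ (IsSymm.sub hq.2 hHs) hD h0)
  refine ⟨_, ?_, by rw [rank_congruence hCR hMN, hr], p, hp, hp1, hp2, ?_⟩
  · simp only [IsSymm, transpose_mul, transpose_transpose, transpose_nonsing_inv, hNs.eq,
      Matrix.mul_assoc]
  · rw [hp3, nnzEntries_eq_card, ← hcard, hS]
    congr 1
    ext ⟨i, j⟩
    simp only [Finset.mem_filter, Finset.mem_univ, true_and]
    constructor
    · intro h; by_contra h'; exact h (hH0 i j h')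
    · intro h h'
      have := hH1 i j h
      rw [h', mul_zero] at this
      exact this.false

/-! ### Kernel certificates and the matrices they define -/

/-- `1` if `|t| = 1`, and `0` otherwise. -/
noncomputable def absOneIndicator (t : ℝ) : ℕ := if |t| = 1 then 1 else 0

theorem absOneIndicator_of_eq {t : ℝ} (h : |t| = 1) : absOneIndicator t = 1 := if_pos h

theorem absOneIndicator_of_lt {t : ℝ} (h : |t| < 1) : absOneIndicator t = 0 := if_neg h.ne

/-- The symmetric matrix `W` with blocks `a, b, c` (two distinguished indices), `u, v` and `Y`
annihilates the vectors `(1, 0, x)` and `(0, 1, y)`, has entries of absolute value at most one,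
exactly `r² + r` of them of absolute value one, and a symmetric matrix
`x pᵀ + p xᵀ + y qᵀ + q yᵀ`, bordered by `p` and `q`, that vanishes where `|W| < 1` is zero. -/
structure IsKernelCertificate {κ : Type*} [Fintype κ] (x y u v : κ → ℝ) (Y : κ → κ → ℝ)
    (a b c : ℝ) : Prop where
  symm : ∀ i j, Y i j = Y j i
  row_ax : a + ∑ i, u i * x i = 0
  row_ay : b + ∑ i, u i * y i = 0
  row_bx : b + ∑ i, v i * x i = 0
  row_by : c + ∑ i, v i * y i = 0
  row_x : ∀ i, u i + ∑ j, Y i j * x j = 0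
  row_y : ∀ i, v i + ∑ j, Y i j * y j = 0
  abs_a : |a| < 1
  abs_b : |b| < 1
  abs_c : |c| < 1
  abs_u : ∀ i, |u i| ≤ 1
  abs_v : ∀ i, |v i| ≤ 1
  abs_Y : ∀ i j, |Y i j| ≤ 1
  indep : ∀ p q : κ → ℝ, (∀ i, |u i| < 1 → p i = 0) → (∀ i, |v i| < 1 → q i = 0) →
    (∀ i j, |Y i j| < 1 → x i * p j + p i * x j + (y i * q j + q i * y j) = 0) →
    ∀ i, p i = 0 ∧ q i = 0
  count : 2 * (∑ i, absOneIndicator (u i)) + 2 * (∑ i, absOneIndicator (v i)) +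
    (∑ i, ∑ j, absOneIndicator (Y i j)) = Fintype.card κ ^ 2 + Fintype.card κ

section
variable {κ ρ : Type*} (x y u v : κ → ℝ) (Y : κ → κ → ℝ) (a b c : ℝ)

/-- The dual matrix of a kernel certificate, padded by zeros. -/
def dualMatrix : Matrix (Unit ⊕ Unit ⊕ κ ⊕ ρ) (Unit ⊕ Unit ⊕ κ ⊕ ρ) ℝ := .of fun s t =>
  match s, t with
  | .inl _, .inl _ => a
  | .inl _, .inr (.inl _) => b
  | .inl _, .inr (.inr (.inl j)) => u j
  | .inr (.inl _), .inl _ => b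
  | .inr (.inl _), .inr (.inl _) => c
  | .inr (.inl _), .inr (.inr (.inl j)) => v j
  | .inr (.inr (.inl i)), .inl _ => u i
  | .inr (.inr (.inl i)), .inr (.inl _) => v i
  | .inr (.inr (.inl i)), .inr (.inr (.inl j)) => Y i j
  | .inr (.inr (.inr _)), _ => 0
  | _, .inr (.inr (.inr _)) => 0

/-- The matrix whose rows are orthogonal to `(1, 0, x)` and `(0, 1, y)`, padded by zeros. -/
def annihilatorMatrix [DecidableEq κ] : Matrix κ (Unit ⊕ Unit ⊕ κ ⊕ ρ) ℝ := .of fun i t =>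
  match t with
  | .inl _ => -x i
  | .inr (.inl _) => -y i
  | .inr (.inr (.inl j)) => if i = j then 1 else 0
  | .inr (.inr (.inr _)) => 0

end

section
variable {κ ρ : Type*} [Fintype κ] [Fintype ρ] {x y u v : κ → ℝ} {Y : κ → κ → ℝ} {a b c : ℝ}

theorem annihilatorMatrix_compress_apply [DecidableEq κ]
    {C : Matrix κ (Unit ⊕ Unit ⊕ κ ⊕ ρ) ℝ} (hC : C = annihilatorMatrix x y)
    (D : Matrix (Unit ⊕ Unit ⊕ κ ⊕ ρ) (Unit ⊕ Unit ⊕ κ ⊕ ρ) ℝ) (hD : D.IsSymm) (i j : κ) :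
    (C * D * Cᵀ) i j =
      x i * x j * D (.inl ()) (.inl ()) +
      (x i * y j + y i * x j) * D (.inl ()) (.inr (.inl ())) +
      y i * y j * D (.inr (.inl ())) (.inr (.inl ())) -
      (x i * D (.inl ()) (.inr (.inr (.inl j))) + D (.inl ()) (.inr (.inr (.inl i))) * x j) -
      (y i * D (.inr (.inl ())) (.inr (.inr (.inl j))) +
        D (.inr (.inl ())) (.inr (.inr (.inl i))) * y j) +
      D (.inr (.inr (.inl i))) (.inr (.inr (.inl j))) := by
  subst hC
  simp only [mul_apply, transpose_apply, annihilatorMatrix, of_apply, Fintype.sum_sum_type,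
    Finset.univ_unique, Finset.sum_singleton, PUnit.default_eq_unit, ite_mul, one_mul, zero_mul,
    mul_ite, mul_one, mul_zero, Finset.sum_ite_eq, Finset.mem_univ, if_true, Finset.sum_const_zero]
  rw [hD.apply (.inl ()) (.inr (.inl ())), hD.apply (.inl ()) (.inr (.inr (.inl i))),
    hD.apply (.inr (.inl ())) (.inr (.inr (.inl i)))]
  ring

/-- Conceptually `W` annihilates `ker C`, so `W = Cᵀ Z C` and its pairing with `D` is that of `Z`
with `C D Cᵀ = 0`. Concretely, `C D Cᵀ = 0` expresses the `κ`-block of `D` through its border, and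
the row relations of `W` collapse the resulting sums. -/
theorem IsKernelCertificate.sum_dualMatrix_mul (h : IsKernelCertificate x y u v Y a b c)
    [DecidableEq κ] {C : Matrix κ (Unit ⊕ Unit ⊕ κ ⊕ ρ) ℝ} (hC : C = annihilatorMatrix x y)
    (D : Matrix (Unit ⊕ Unit ⊕ κ ⊕ ρ) (Unit ⊕ Unit ⊕ κ ⊕ ρ) ℝ) (hD : D.IsSymm)
    (h0 : C * D * Cᵀ = 0) :
    ∑ s, ∑ t, dualMatrix u v Y a b c s t * D s t = 0 := by
  set A := D (.inl ()) (.inl ())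
  set B := D (.inl ()) (.inr (.inl ()))
  set E := D (.inr (.inl ())) (.inr (.inl ()))
  let p : κ → ℝ := fun i => D (.inl ()) (.inr (.inr (.inl i)))
  let q : κ → ℝ := fun i => D (.inr (.inl ())) (.inr (.inr (.inl i)))
  have hx : ∀ i, ∑ j, Y i j * x j = -u i := fun i => by linarith [h.row_x i]
  have hy : ∀ i, ∑ j, Y i j * y j = -v i := fun i => by linarith [h.row_y i]
  have hxr : ∀ f : κ → ℝ, ∑ i, ∑ j, Y i j * (f i * x j) = -∑ i, u i * f i := fun f => by
    rw [← Finset.sum_neg_distrib]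
    refine Finset.sum_congr rfl fun i _ => ?_
    rw [← neg_mul, ← hx, Finset.sum_mul]
    exact Finset.sum_congr rfl fun j _ => by ring
  have hyr : ∀ f : κ → ℝ, ∑ i, ∑ j, Y i j * (f i * y j) = -∑ i, v i * f i := fun f => by
    rw [← Finset.sum_neg_distrib]
    refine Finset.sum_congr rfl fun i _ => ?_
    rw [← neg_mul, ← hy, Finset.sum_mul]
    exact Finset.sum_congr rfl fun j _ => by ring
  have hswap : ∀ f g : κ → ℝ, ∑ i, ∑ j, Y i j * (f i * g j) = ∑ i, ∑ j, Y i j * (g i * f j) :=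
    fun f g => by
      rw [Finset.sum_comm]
      exact Finset.sum_congr rfl fun i _ => Finset.sum_congr rfl fun j _ => by
        rw [h.symm j i]; ring
  have hij : ∀ i j, D (.inr (.inr (.inl i))) (.inr (.inr (.inl j))) =
      x i * p j + p i * x j + (y i * q j + q i * y j) -
        A * (x i * x j) - B * (x i * y j) - B * (y i * x j) - E * (y i * y j) := fun i j => by
    have := annihilatorMatrix_compress_apply hC D hD i j
    rw [h0, Matrix.zero_apply] at this
    simp only [p, q, A, B, E]
    linarith
  have hYD : ∑ i, ∑ j, Y i j * D (.inr (.inr (.inl i))) (.inr (.inr (.inl j))) =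
      -2 * ∑ i, u i * p i - 2 * ∑ i, v i * q i - a * A - 2 * b * B - c * E := by
    have e1 := hswap x p
    have e2 := hswap y q
    have e3 := hxr x
    have e4 := hxr y
    have e5 := hyr x
    have e6 := hyr y
    rw [hxr p] at e1
    rw [hyr q] at e2
    calc _ = ∑ i, ∑ j, (Y i j * (x i * p j) + Y i j * (p i * x j) + Y i j * (y i * q j) +
          Y i j * (q i * y j) - A * (Y i j * (x i * x j)) - B * (Y i j * (x i * y j))
          - B * (Y i j * (y i * x j)) - E * (Y i j * (y i * y j))) :=
          Finset.sum_congr rfl fun i _ => Finset.sum_congr rfl fun j _ => by rw [hij]; ring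
      _ = _ := by
          simp only [Finset.sum_add_distrib, Finset.sum_sub_distrib, ← Finset.mul_sum]
          rw [e1, e2, e3, e4, e5, e6, hxr p, hyr q]
          have := h.row_ax
          have := h.row_ay
          have := h.row_bx
          have := h.row_by
          rw [show ∑ i, u i * x i = -a by linarith, show ∑ i, u i * y i = -b by linarith,
            show ∑ i, v i * x i = -b by linarith, show ∑ i, v i * y i = -c by linarith]
          ring
  simp only [Fintype.sum_sum_type, dualMatrix, of_apply, Finset.univ_unique, Finset.sum_singleton,
    PUnit.default_eq_unit, zero_mul, Finset.sum_const_zero, add_zero, Finset.sum_add_distrib]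
  rw [hYD, hD.apply (.inl ()) (.inr (.inl ())),
    show ∑ i, u i * D (.inr (.inr (.inl i))) (.inl ()) = ∑ i, u i * p i from
      Finset.sum_congr rfl fun i _ => by rw [hD.apply],
    show ∑ i, v i * D (.inr (.inr (.inl i))) (.inr (.inl ())) = ∑ i, v i * q i from
      Finset.sum_congr rfl fun i _ => by rw [hD.apply]]
  simp only [p, q, A, B, E]
  ring

/-- Since `|a|, |b|, |c| < 1`, the corner entries of `D` vanish, and its `κ`-block becomes `x pᵀ + p
xᵀ + y qᵀ + q yᵀ` with `p`, `q` the border rows, which is the situation of `indep`. -/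
theorem IsKernelCertificate.eq_zero_of_compress_eq_zero (h : IsKernelCertificate x y u v Y a b c)
    [DecidableEq κ] {C : Matrix κ (Unit ⊕ Unit ⊕ κ ⊕ ρ) ℝ} (hC : C = annihilatorMatrix x y)
    (D : Matrix (Unit ⊕ Unit ⊕ κ ⊕ ρ) (Unit ⊕ Unit ⊕ κ ⊕ ρ) ℝ) (hD : D.IsSymm)
    (h0 : C * D * Cᵀ = 0)
    (hW : ∀ s t, |dualMatrix u v Y a b c s t| < 1 → D s t = 0) : D = 0 := by
  have hA : D (.inl ()) (.inl ()) = 0 := hW _ _ h.abs_a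
  have hB : D (.inl ()) (.inr (.inl ())) = 0 := hW _ _ h.abs_b
  have hE : D (.inr (.inl ())) (.inr (.inl ())) = 0 := hW _ _ h.abs_c
  have hij : ∀ i j, D (.inr (.inr (.inl i))) (.inr (.inr (.inl j))) =
      x i * D (.inl ()) (.inr (.inr (.inl j))) + D (.inl ()) (.inr (.inr (.inl i))) * x j +
      (y i * D (.inr (.inl ())) (.inr (.inr (.inl j))) +
        D (.inr (.inl ())) (.inr (.inr (.inl i))) * y j) := fun i j => by
    have := annihilatorMatrix_compress_apply hC D hD i j
    rw [h0, Matrix.zero_apply, hA, hB, hE] at this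
    linarith
  have hpq := h.indep (fun i => D (.inl ()) (.inr (.inr (.inl i))))
    (fun i => D (.inr (.inl ())) (.inr (.inr (.inl i))))
    (fun i hi => hW _ _ hi) (fun i hi => hW _ _ hi)
    (fun i j hlt => by rw [← hij]; exact hW _ _ hlt)
  have hρ : ∀ s t, D s (.inr (.inr (.inr t))) = 0 := fun s t => hW _ _ (by
    rcases s with _ | _ | _ | _ <;> simp [dualMatrix])
  ext s t
  rw [Matrix.zero_apply]
  rcases s with _ | _ | i | s <;> rcases t with _ | _ | j | t <;>
    first
    | exact hρ _ _
    | exact hA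
    | exact hB
    | exact hE
    | exact (hpq _).1
    | exact (hpq _).2
    | exact (hD.apply _ _).trans hB
    | exact (hD.apply _ _).trans (hρ _ _)
    | exact (hD.apply _ _).trans (hpq _).1
    | exact (hD.apply _ _).trans (hpq _).2
    | rw [hij, (hpq _).1, (hpq _).1, (hpq _).2, (hpq _).2]; ring

/-- The `n - (r + 2)` surplus coordinates are padding: `C` and `W` vanish there, so they add no
entries of modulus one and uniqueness forces zeros. -/
theorem IsKernelCertificate.exists_sharp (h : IsKernelCertificate x y u v Y a b c) {n r : ℕ}
    (hr : Fintype.card κ = r) (hn : r + 2 ≤ n) :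
    ∃ A : Matrix (Fin n) (Fin n) ℝ, A.IsSymm ∧ A.rank = r ∧
      ∃ p ∈ (symGinvRegion A).extremePoints ℝ, IsLPOptimal (symGinvRegion A) p ∧
        (∀ q, IsLPOptimal (symGinvRegion A) q → q = p) ∧
        nnzEntries (p.1 - p.2) = r ^ 2 + r := by
  classical
  have hcard : Fintype.card (Unit ⊕ Unit ⊕ κ ⊕ Fin (n - (r + 2))) = n := by
    simp only [Fintype.card_sum, Fintype.card_unit, Fintype.card_fin, hr]; omega
  let e : (Unit ⊕ Unit ⊕ κ ⊕ Fin (n - (r + 2))) ≃ Fin n := Fintype.equivFinOfCardEq hcard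
  let C' : Matrix κ (Unit ⊕ Unit ⊕ κ ⊕ Fin (n - (r + 2))) ℝ := annihilatorMatrix x y
  let W' := dualMatrix (ρ := Fin (n - (r + 2))) u v Y a b c
  let R' : Matrix (Unit ⊕ Unit ⊕ κ ⊕ Fin (n - (r + 2))) κ ℝ := .of fun t i =>
    match t with
    | .inr (.inr (.inl j)) => if j = i then 1 else 0
    | _ => 0
  have hCR : C'.submatrix id e.symm * R'.submatrix e.symm id = 1 := by
    rw [submatrix_mul_equiv]
    ext i j
    simp [C', R', annihilatorMatrix, mul_apply, one_apply, Fintype.sum_sum_type]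
  have hcomp : ∀ D : Matrix (Fin n) (Fin n) ℝ,
      C'.submatrix id e.symm * D * (C'.submatrix id e.symm)ᵀ = C' * D.submatrix e e * C'ᵀ := by
    intro D
    have : D = (D.submatrix e e).submatrix e.symm e.symm := by simp
    conv_lhs => rw [this]
    rw [transpose_submatrix, submatrix_mul_equiv, submatrix_mul_equiv, submatrix_id_id]
  have hW's : W'.IsSymm := by
    ext s t
    rcases s with _ | _ | i | s <;> rcases t with _ | _ | j | t <;>
      first
      | rfl
      | exact h.symm _ _
  have hW'le : ∀ s t, |W' s t| ≤ 1 := by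
    intro s t
    rcases s with _ | _ | i | s <;> rcases t with _ | _ | j | t <;>
      first
      | exact h.abs_a.le
      | exact h.abs_b.le
      | exact h.abs_c.le
      | exact h.abs_u _
      | exact h.abs_v _
      | exact h.abs_Y _ _
      | exact (abs_zero (α := ℝ)).trans_le zero_le_one
  refine exists_sharp_symGinvRegion_of_certificate hr hCR (W'.submatrix e.symm e.symm)
    (hW's.submatrix _) (fun i j => hW'le _ _) (fun D hD hD0 => ?_) (fun D hD hD0 hW0 => ?_) ?_
  · rw [hcomp] at hD0
    rw [← h.sum_dualMatrix_mul rfl (D.submatrix e e) (hD.submatrix _) hD0, ← e.sum_comp]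
    refine Finset.sum_congr rfl fun s _ => ?_
    rw [← e.sum_comp]
    exact Finset.sum_congr rfl fun t _ => by simp [W']
  · rw [hcomp] at hD0
    have := h.eq_zero_of_compress_eq_zero rfl (D.submatrix e e) (hD.submatrix _) hD0
      fun s t hst => hW0 _ _ (by simpa [W'] using hst)
    ext i j
    simpa using congrFun (congrFun this (e.symm i)) (e.symm j)
  · have hcount := h.count
    rw [hr] at hcount
    have hsum : (∑ i, ∑ j, if |W'.submatrix e.symm e.symm i j| = 1 then 1 else 0) =
        ∑ s, ∑ t, absOneIndicator (W' s t) := by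
      rw [← e.symm.sum_comp]
      exact Finset.sum_congr rfl fun i _ =>
        e.symm.sum_comp fun t => absOneIndicator (W' (e.symm i) t)
    rw [Finset.card_filter, Fintype.sum_prod_type, ← hcount, hsum]
    simp only [Fintype.sum_sum_type, W', dualMatrix, of_apply, Finset.univ_unique,
      Finset.sum_singleton, PUnit.default_eq_unit, Finset.sum_add_distrib,
      absOneIndicator_of_lt h.abs_a, absOneIndicator_of_lt h.abs_b,
      absOneIndicator_of_lt h.abs_c, absOneIndicator_of_lt (abs_zero.trans_lt (one_pos (α := ℝ))),
      Finset.sum_const_zero, zero_add, add_zero]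
    ring

end

/-! ### Extending a certificate by four indices -/

/-- A signed sum of all vectors `(x i, y i)`, together with `± (0, 1)`, is `(s, 0)` with
`|s| < 1`. -/
def HasSignRelation {κ : Type*} [Fintype κ] (x y : κ → ℝ) : Prop :=
  ∃ (α : κ → ℝ) (α₀ : ℝ), |α₀| = 1 ∧ (∀ i, |α i| = 1) ∧ α₀ + ∑ i, α i * y i = 0 ∧
    |∑ i, α i * x i| < 1

/-- The new vectors come in two equal pairs, which opposite signs cancel, so the relation survives
every extension. -/
theorem HasSignRelation.sumElim {κ : Type*} [Fintype κ] {x y : κ → ℝ} (h : HasSignRelation x y)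
    (s t s' t' : ℝ) :
    HasSignRelation (Sum.elim x ![s, t, s, t]) (Sum.elim y ![s', t', s', t']) := by
  obtain ⟨α, α₀, h0, h1, h2, h3⟩ := h
  refine ⟨Sum.elim α ![1, 1, -1, -1], α₀, h0, ?_, ?_, ?_⟩
  · simp [Sum.forall, Fin.forall_fin_succ, h1]
  · simp [Fintype.sum_sum_type, Fin.sum_univ_four, ← h2]
  · convert h3 using 2
    simp [Fintype.sum_sum_type, Fin.sum_univ_four]

/-- The new indices carry small vectors, equal within the pairs `0, 2` and `1, 3`, and the columns
of `Y` joining them to old indices are `α, β, -α, -β`. Old row relations are unchanged because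
opposite columns cancel; new ones hold by the sign relations, with `u` or `v` absorbing the defects
`s`, `s'`. The count of entries of modulus one grows by `8k + 12 + 8 = (k + 4)² + (k + 4) - k² - k`,
where `k` is the old size. -/
theorem IsKernelCertificate.exists_extend {κ : Type*} [Fintype κ] {x y u v : κ → ℝ}
    {Y : κ → κ → ℝ} {a b c : ℝ} (h : IsKernelCertificate x y u v Y a b c)
    (hα : HasSignRelation x y) (hβ : HasSignRelation y x) :
    ∃ (x' y' u' v' : κ ⊕ Fin 4 → ℝ) (Y' : κ ⊕ Fin 4 → κ ⊕ Fin 4 → ℝ) (a' b' c' : ℝ),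
      IsKernelCertificate x' y' u' v' Y' a' b' c' ∧ HasSignRelation x' y' ∧
        HasSignRelation y' x' := by
  classical
  have hα' := hα
  have hβ' := hβ
  obtain ⟨α, α₀, hα0, hα1, hα2, hα3⟩ := hα
  obtain ⟨β, β₀, hβ0, hβ1, hβ2, hβ3⟩ := hβ
  set s := ∑ i, α i * x i with hs
  set s' := ∑ i, β i * y i with hs'
  -- All later shifts, `3 * ε`, `6 * ε²` and `12 * ε²`, are at most `12 * ε`, so the strict bounds
  -- survive.
  obtain ⟨ε, hε0, hε1, hεs, hεs', hεa, hεb, hεc⟩ : ∃ ε : ℝ, 0 < ε ∧ ε ≤ 1 ∧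
      12 * ε < 1 - |s| ∧ 12 * ε < 1 - |s'| ∧ 12 * ε < 1 - |a| ∧ 12 * ε < 1 - |b| ∧
      12 * ε < 1 - |c| := by
    set m := min (1 - |s|) (min (1 - |s'|) (min (1 - |a|) (min (1 - |b|) (1 - |c|)))) with hm
    have hm0 : 0 < m := by
      simp only [hm, lt_min_iff, sub_pos]
      exact ⟨hα3, hβ3, h.abs_a, h.abs_b, h.abs_c⟩
    have hlt : m / 13 * 12 < m := by linarith
    have hle : ∀ {z}, m ≤ z → 12 * (m / 13) < z := fun hz => by linarith
    have hm1 : m ≤ 1 - |s| := min_le_left _ _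
    refine ⟨m / 13, by positivity, by linarith [abs_nonneg s], hle hm1, hle ?_, hle ?_, hle ?_,
      hle ?_⟩ <;> simp [hm]
  have hεε : ε * ε ≤ ε := by nlinarith
  have hεε0 : 0 < ε * ε := mul_pos hε0 hε0
  have hshift : ∀ {z w : ℝ}, |w| ≤ 12 * ε → 12 * ε < 1 - |z| → |z + w| < 1 := fun {z w} h1 h2 =>
    (abs_add_le z w).trans_lt (by linarith)
  have h3ε : |-(3 * ε)| ≤ 12 * ε := by rw [abs_neg, abs_of_pos (by linarith)]; linarith
  have hu0 : |-s + -(3 * ε)| < 1 := hshift h3ε (by rwa [abs_neg])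
  have hu2 : |s + -(3 * ε)| < 1 := hshift h3ε hεs
  have hv1 : |-s' + -(3 * ε)| < 1 := hshift h3ε (by rwa [abs_neg])
  have hv3 : |s' + -(3 * ε)| < 1 := hshift h3ε hεs'
  have hx : ∀ i, u i + ∑ j, Y i j * x j = 0 := h.row_x
  have hy : ∀ i, v i + ∑ j, Y i j * y j = 0 := h.row_y
  refine ⟨Sum.elim x ![ε, 2 * ε, ε, 2 * ε], Sum.elim y ![2 * ε, ε, 2 * ε, ε],
    Sum.elim u ![-s + -(3 * ε), β₀, s + -(3 * ε), -β₀],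
    Sum.elim v ![α₀, -s' + -(3 * ε), -α₀, s' + -(3 * ε)],
    Sum.elim (fun i => Sum.elim (Y i) ![α i, β i, -α i, -β i])
      (fun k => Sum.elim (fun j => ![α j, β j, -α j, -β j] k)
        (![![0, 1, -1, 1], ![1, 0, 1, -1], ![-1, 1, 0, 1], ![1, -1, 1, 0]] k)),
    -- In the corner relations `s`, `s'`, `α₀`, `β₀` cancel within pairs; only the `-(3 * ε)` terms
    -- against the new vectors remain to be compensated.
    a + 6 * (ε * ε), b + 12 * (ε * ε), c + 6 * (ε * ε), ?_, hα'.sumElim _ _ _ _,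
    hβ'.sumElim _ _ _ _⟩
  constructor
  · simp [Sum.forall, Fin.forall_fin_succ, h.symm]
  · rw [← h.row_ax]; simp [Fintype.sum_sum_type, Fin.sum_univ_four]; ring
  · rw [← h.row_ay]; simp [Fintype.sum_sum_type, Fin.sum_univ_four]; ring
  · rw [← h.row_bx]; simp [Fintype.sum_sum_type, Fin.sum_univ_four]; ring
  · rw [← h.row_by]; simp [Fintype.sum_sum_type, Fin.sum_univ_four]; ring
  · rw [Sum.forall]
    refine ⟨fun i => ?_, ?_⟩
    · rw [← hx i]; simp [Fintype.sum_sum_type, Fin.sum_univ_four]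
    · simp only [Fin.forall_fin_succ, Fintype.sum_sum_type, Fin.sum_univ_four]
      simp [← hs]
      refine ⟨?_, ?_, ?_, ?_⟩ <;> linarith
  · rw [Sum.forall]
    refine ⟨fun i => ?_, ?_⟩
    · rw [← hy i]; simp [Fintype.sum_sum_type, Fin.sum_univ_four]
    · simp only [Fin.forall_fin_succ, Fintype.sum_sum_type, Fin.sum_univ_four]
      simp [← hs']
      refine ⟨?_, ?_, ?_, ?_⟩ <;> linarith
  · exact hshift (by rw [abs_of_pos (by positivity)]; linarith) hεa
  · exact hshift (by rw [abs_of_pos (by positivity)]; linarith) hεb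
  · exact hshift (by rw [abs_of_pos (by positivity)]; linarith) hεc
  · simp only [Sum.forall, Fin.forall_fin_succ]
    simp [h.abs_u, hβ0, hu0.le, hu2.le]
  · simp only [Sum.forall, Fin.forall_fin_succ]
    simp [h.abs_v, hα0, hv1.le, hv3.le]
  · simp only [Sum.forall, Fin.forall_fin_succ]
    simp [h.abs_Y, hα1, hβ1]
  · intro p q hp hq hY
    have p0 : p (.inr 0) = 0 := hp (.inr 0) hu0
    have p2 : p (.inr 2) = 0 := hp (.inr 2) hu2
    have q1 : q (.inr 1) = 0 := hq (.inr 1) hv1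
    have q3 : q (.inr 3) = 0 := hq (.inr 3) hv3
    have q0 : q (.inr 0) = 0 := by
      have := hY (.inr 0) (.inr 0) (by simp)
      simp [p0] at this
      have h' : ε * q (.inr 0) = 0 := by linarith
      exact (mul_eq_zero.1 h').resolve_left hε0.ne'
    have q2 : q (.inr 2) = 0 := by
      have := hY (.inr 2) (.inr 2) (by simp)
      simp [p2] at this
      have h' : ε * q (.inr 2) = 0 := by linarith
      exact (mul_eq_zero.1 h').resolve_left hε0.ne'
    have p1 : p (.inr 1) = 0 := by
      have := hY (.inr 1) (.inr 1) (by simp)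
      simp [q1] at this
      have h' : ε * p (.inr 1) = 0 := by linarith
      exact (mul_eq_zero.1 h').resolve_left hε0.ne'
    have p3 : p (.inr 3) = 0 := by
      have := hY (.inr 3) (.inr 3) (by simp)
      simp [q3] at this
      have h' : ε * p (.inr 3) = 0 := by linarith
      exact (mul_eq_zero.1 h').resolve_left hε0.ne'
    have hold := h.indep (fun i => p (.inl i)) (fun i => q (.inl i)) (fun i => hp (.inl i))
      (fun i => hq (.inl i)) (fun i j => hY (.inl i) (.inl j))
    rw [Sum.forall]
    exact ⟨hold, by simp [Fin.forall_fin_succ, p0, p1, p2, p3, q0, q1, q2, q3]⟩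
  · simp only [Fintype.sum_sum_type, Fin.sum_univ_four, Fintype.card_sum, Fintype.card_fin]
    have hα : ∀ i, absOneIndicator (α i) = 1 := fun i => absOneIndicator_of_eq (hα1 i)
    have hβ : ∀ i, absOneIndicator (β i) = 1 := fun i => absOneIndicator_of_eq (hβ1 i)
    have hneg : ∀ t : ℝ, absOneIndicator (-t) = absOneIndicator t := fun t => by
      rw [absOneIndicator, abs_neg, absOneIndicator]
    have h1 : absOneIndicator 1 = 1 := absOneIndicator_of_eq abs_one
    have h0 : absOneIndicator 0 = 0 := absOneIndicator_of_lt (abs_zero.trans_lt one_pos)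
    simp only [Sum.elim_inl, Sum.elim_inr, Matrix.cons_val, hneg, hα, hβ, h0, h1,
      absOneIndicator_of_eq hα0, absOneIndicator_of_eq hβ0, absOneIndicator_of_lt hu0,
      absOneIndicator_of_lt hu2, absOneIndicator_of_lt hv1, absOneIndicator_of_lt hv3,
      Finset.sum_add_distrib, Finset.sum_const, Finset.card_univ, smul_eq_mul]
    linarith [h.count]

/-! ### Explicit certificates and the induction -/

theorem exists_isKernelCertificate_three :
    ∃ (x y u v : Fin 3 → ℝ) (Y : Fin 3 → Fin 3 → ℝ) (a b c : ℝ),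
      IsKernelCertificate x y u v Y a b c := by
  refine ⟨![-1 / 2, 3 / 2, 3 / 4], ![-1, -1 / 2, 0],
    ![-1, 1 / 2, -1], ![0, 1, -1],
    ![![-1 / 2, 1, -1],
      ![1, 0, 0],
      ![-1, 0, 2 / 3]],
    -1 / 2, -3 / 4, 1 / 2, ?_⟩
  · constructor
    case indep =>
      intro p q hp hq hY
      have q0 := hq 0 (by simp only [Matrix.cons_val]; norm_num [abs_lt])
      have p1 := hp 1 (by simp only [Matrix.cons_val]; norm_num [abs_lt])
      have e12 := hY 1 2 (by simp only [Matrix.cons_val]; norm_num [abs_lt])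
      have e00 := hY 0 0 (by simp only [Matrix.cons_val]; norm_num [abs_lt])
      have e11 := hY 1 1 (by simp only [Matrix.cons_val]; norm_num [abs_lt])
      have e22 := hY 2 2 (by simp only [Matrix.cons_val]; norm_num [abs_lt])
      simp only [Matrix.cons_val] at e12 e00 e11 e22
      clear hp hq hY
      have h0 : p 0 = 0 ∧ q 0 = 0 := ⟨by linarith, by linarith⟩
      have h1 : p 1 = 0 ∧ q 1 = 0 := ⟨by linarith, by linarith⟩
      have h2 : p 2 = 0 ∧ q 2 = 0 := ⟨by linarith, by linarith⟩
      intro i; fin_cases i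
      exacts [h0, h1, h2]
    case count =>
      simp only [Fin.sum_univ_three, Matrix.cons_val, absOneIndicator, Fintype.card_fin]
      norm_num [abs_div]
    all_goals norm_num [Fin.forall_fin_succ, Fin.sum_univ_succ, abs_le, abs_lt]

theorem exists_isKernelCertificate_four :
    ∃ (x y u v : Fin 4 → ℝ) (Y : Fin 4 → Fin 4 → ℝ) (a b c : ℝ),
      IsKernelCertificate x y u v Y a b c ∧ HasSignRelation x y ∧
        HasSignRelation y x := by
  refine ⟨![1 / 2, -1, 0, 1 / 2], ![1, -1 / 2, -1 / 2, 0],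
    ![-1, 0, -1, 1], ![0, 1, -1, 1],
    ![![0, -1, 1, 0],
      ![-1, 0, 0, 1],
      ![1, 0, 0, 1],
      ![0, 1, 1, 0]],
    0, 1 / 2, 0, ?_,
    ⟨![1, 1, -1, 1], -1, ?_, ?_, ?_, ?_⟩,
    ⟨![-1, -1, -1, 1], -1, ?_, ?_, ?_, ?_⟩⟩
  · constructor
    case indep =>
      intro p q hp hq hY
      have q0 := hq 0 (by simp only [Matrix.cons_val]; norm_num [abs_lt])
      have p1 := hp 1 (by simp only [Matrix.cons_val]; norm_num [abs_lt])
      have e12 := hY 1 2 (by simp only [Matrix.cons_val]; norm_num [abs_lt])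
      have e03 := hY 0 3 (by simp only [Matrix.cons_val]; norm_num [abs_lt])
      have e00 := hY 0 0 (by simp only [Matrix.cons_val]; norm_num [abs_lt])
      have e11 := hY 1 1 (by simp only [Matrix.cons_val]; norm_num [abs_lt])
      have e22 := hY 2 2 (by simp only [Matrix.cons_val]; norm_num [abs_lt])
      have e33 := hY 3 3 (by simp only [Matrix.cons_val]; norm_num [abs_lt])
      simp only [Matrix.cons_val] at e12 e03 e00 e11 e22 e33
      clear hp hq hY
      have h0 : p 0 = 0 ∧ q 0 = 0 := ⟨by linarith, by linarith⟩
      have h1 : p 1 = 0 ∧ q 1 = 0 := ⟨by linarith, by linarith⟩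
      have h2 : p 2 = 0 ∧ q 2 = 0 := ⟨by linarith, by linarith⟩
      have h3 : p 3 = 0 ∧ q 3 = 0 := ⟨by linarith, by linarith⟩
      intro i; fin_cases i
      exacts [h0, h1, h2, h3]
    case count =>
      simp only [Fin.sum_univ_four, Matrix.cons_val, absOneIndicator, Fintype.card_fin]
      norm_num [abs_div]
    all_goals norm_num [Fin.forall_fin_succ, Fin.sum_univ_succ, abs_le, abs_lt]
  all_goals norm_num [Fin.forall_fin_succ, Fin.sum_univ_succ, abs_lt]

theorem exists_isKernelCertificate_five :
    ∃ (x y u v : Fin 5 → ℝ) (Y : Fin 5 → Fin 5 → ℝ) (a b c : ℝ),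
      IsKernelCertificate x y u v Y a b c ∧ HasSignRelation x y ∧
        HasSignRelation y x := by
  refine ⟨![-1, -1 / 2, -1 / 2, 1, 0], ![-2, 1, -2, 3 / 2, 3 / 2],
    ![-1, -1 / 2, -1 / 2, -1, -1], ![1 / 2, -1, -1, -1, 1],
    ![![0, -1, -1, 0, -1],
      ![-1, 0, -1, -1, -1],
      ![-1, -1, 0, -1, 1],
      ![0, -1, -1, 0, 0],
      ![-1, -1, 1, 0, 0]],
    -1 / 2, 1 / 2, 0, ?_,
    ⟨![-1, -1, 1, -1, 1], 1, ?_, ?_, ?_, ?_⟩,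
    ⟨![1, 1, 1, 1, 1], 1, ?_, ?_, ?_, ?_⟩⟩
  · constructor
    case indep =>
      intro p q hp hq hY
      have q0 := hq 0 (by simp only [Matrix.cons_val]; norm_num [abs_lt])
      have p1 := hp 1 (by simp only [Matrix.cons_val]; norm_num [abs_lt])
      have p2 := hp 2 (by simp only [Matrix.cons_val]; norm_num [abs_lt])
      have e03 := hY 0 3 (by simp only [Matrix.cons_val]; norm_num [abs_lt])
      have e34 := hY 3 4 (by simp only [Matrix.cons_val]; norm_num [abs_lt])
      have e00 := hY 0 0 (by simp only [Matrix.cons_val]; norm_num [abs_lt])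
      have e11 := hY 1 1 (by simp only [Matrix.cons_val]; norm_num [abs_lt])
      have e22 := hY 2 2 (by simp only [Matrix.cons_val]; norm_num [abs_lt])
      have e33 := hY 3 3 (by simp only [Matrix.cons_val]; norm_num [abs_lt])
      have e44 := hY 4 4 (by simp only [Matrix.cons_val]; norm_num [abs_lt])
      simp only [Matrix.cons_val] at e03 e34 e00 e11 e22 e33 e44
      clear hp hq hY
      have h0 : p 0 = 0 ∧ q 0 = 0 := ⟨by linarith, by linarith⟩
      have h1 : p 1 = 0 ∧ q 1 = 0 := ⟨by linarith, by linarith⟩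
      have h2 : p 2 = 0 ∧ q 2 = 0 := ⟨by linarith, by linarith⟩
      have h3 : p 3 = 0 ∧ q 3 = 0 := ⟨by linarith, by linarith⟩
      have h4 : p 4 = 0 ∧ q 4 = 0 := ⟨by linarith, by linarith⟩
      intro i; fin_cases i
      exacts [h0, h1, h2, h3, h4]
    case count =>
      simp only [Fin.sum_univ_five, Matrix.cons_val, absOneIndicator, Fintype.card_fin]
      norm_num [abs_div]
    all_goals norm_num [Fin.forall_fin_succ, Fin.sum_univ_succ, abs_le, abs_lt]
  all_goals norm_num [Fin.forall_fin_succ, Fin.sum_univ_succ, abs_lt]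

theorem exists_isKernelCertificate_six :
    ∃ (x y u v : Fin 6 → ℝ) (Y : Fin 6 → Fin 6 → ℝ) (a b c : ℝ),
      IsKernelCertificate x y u v Y a b c ∧ HasSignRelation x y ∧
        HasSignRelation y x := by
  refine ⟨![-1 / 2, 0, 0, -1, -1, 1 / 2], ![1, -3 / 2, -3 / 2, -1 / 2, 3 / 2, -1],
    ![1 / 2, 0, -1, 1, -1, -1 / 2], ![1, 1, -1, -1 / 2, -1, -1],
    ![![0, 1, -1, 1, -1, -1],
      ![1, 1 / 3, -1, 1, -1, 1],
      ![-1, -1, -2 / 3, 0, -1, -1],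
      ![1, 1, 0, 0, 0, -1],
      ![-1, -1, -1, 0, 0, 1],
      ![-1, 1, -1, -1, 1, 0]],
    1 / 2, -1 / 2, -3 / 4, ?_,
    ⟨![1, 1, 1, -1, 1, 1], 1, ?_, ?_, ?_, ?_⟩,
    ⟨![-1, -1, 1, -1, 1, 1], -1, ?_, ?_, ?_, ?_⟩⟩
  · constructor
    case indep =>
      intro p q hp hq hY
      have p0 := hp 0 (by simp only [Matrix.cons_val]; norm_num [abs_lt])
      have p1 := hp 1 (by simp only [Matrix.cons_val]; norm_num [abs_lt])
      have e23 := hY 2 3 (by simp only [Matrix.cons_val]; norm_num [abs_lt])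
      have q3 := hq 3 (by simp only [Matrix.cons_val]; norm_num [abs_lt])
      have e34 := hY 3 4 (by simp only [Matrix.cons_val]; norm_num [abs_lt])
      have p5 := hp 5 (by simp only [Matrix.cons_val]; norm_num [abs_lt])
      have e00 := hY 0 0 (by simp only [Matrix.cons_val]; norm_num [abs_lt])
      have e11 := hY 1 1 (by simp only [Matrix.cons_val]; norm_num [abs_lt])
      have e22 := hY 2 2 (by simp only [Matrix.cons_val]; norm_num [abs_lt])
      have e33 := hY 3 3 (by simp only [Matrix.cons_val]; norm_num [abs_lt])
      have e44 := hY 4 4 (by simp only [Matrix.cons_val]; norm_num [abs_lt])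
      have e55 := hY 5 5 (by simp only [Matrix.cons_val]; norm_num [abs_lt])
      simp only [Matrix.cons_val] at e23 e34 e00 e11 e22 e33 e44 e55
      clear hp hq hY
      have h0 : p 0 = 0 ∧ q 0 = 0 := ⟨by linarith, by linarith⟩
      have h1 : p 1 = 0 ∧ q 1 = 0 := ⟨by linarith, by linarith⟩
      have h2 : p 2 = 0 ∧ q 2 = 0 := ⟨by linarith, by linarith⟩
      have h3 : p 3 = 0 ∧ q 3 = 0 := ⟨by linarith, by linarith⟩
      have h4 : p 4 = 0 ∧ q 4 = 0 := ⟨by linarith, by linarith⟩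
      have h5 : p 5 = 0 ∧ q 5 = 0 := ⟨by linarith, by linarith⟩
      intro i; fin_cases i
      exacts [h0, h1, h2, h3, h4, h5]
    case count =>
      simp only [Fin.sum_univ_six, Matrix.cons_val, absOneIndicator, Fintype.card_fin]
      norm_num [abs_div]
    all_goals norm_num [Fin.forall_fin_succ, Fin.sum_univ_succ, abs_le, abs_lt]
  all_goals norm_num [Fin.forall_fin_succ, Fin.sum_univ_succ, abs_lt]

theorem exists_isKernelCertificate_seven :
    ∃ (x y u v : Fin 7 → ℝ) (Y : Fin 7 → Fin 7 → ℝ) (a b c : ℝ),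
      IsKernelCertificate x y u v Y a b c ∧ HasSignRelation x y ∧
        HasSignRelation y x := by
  refine ⟨![0, 3 / 2, 2, -1, 1 / 2, -3 / 2, 3 / 2], ![1, -3 / 2, -2, 0, 1 / 2, 1, 0],
    ![1, 1, -1, -1, -1, -1 / 2, -1], ![1, -1, 1, 0, 0, -1, -1],
    ![![0, 1, 1 / 2, 1, 1, 1, -1],
      ![1, -2 / 3, 1, -1, 0, 1, -1],
      ![1 / 2, 1, 0, 1, 1, -1 / 2, -1 / 2],
      ![1, -1, 1, 0, 1, -1, -1],
      ![1, 0, 1, 1, 0, 1, 1],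
      ![1, 1, -1 / 2, -1, 1, 0, -1],
      ![-1, -1, -1 / 2, -1, 1, -1, 1 / 3]],
    3 / 4, -1 / 2, 1 / 2, ?_,
    ⟨![-1, -1, -1, -1, -1, -1, 1], -1, ?_, ?_, ?_, ?_⟩,
    ⟨![1, 1, -1, 1, -1, -1, 1], -1, ?_, ?_, ?_, ?_⟩⟩
  · constructor
    case indep =>
      intro p q hp hq hY
      have e02 := hY 0 2 (by simp only [Matrix.cons_val]; norm_num [abs_lt])
      have e14 := hY 1 4 (by simp only [Matrix.cons_val]; norm_num [abs_lt])
      have e25 := hY 2 5 (by simp only [Matrix.cons_val]; norm_num [abs_lt])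
      have q3 := hq 3 (by simp only [Matrix.cons_val]; norm_num [abs_lt])
      have q4 := hq 4 (by simp only [Matrix.cons_val]; norm_num [abs_lt])
      have p5 := hp 5 (by simp only [Matrix.cons_val]; norm_num [abs_lt])
      have e26 := hY 2 6 (by simp only [Matrix.cons_val]; norm_num [abs_lt])
      have e00 := hY 0 0 (by simp only [Matrix.cons_val]; norm_num [abs_lt])
      have e11 := hY 1 1 (by simp only [Matrix.cons_val]; norm_num [abs_lt])
      have e22 := hY 2 2 (by simp only [Matrix.cons_val]; norm_num [abs_lt])
      have e33 := hY 3 3 (by simp only [Matrix.cons_val]; norm_num [abs_lt])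
      have e44 := hY 4 4 (by simp only [Matrix.cons_val]; norm_num [abs_lt])
      have e55 := hY 5 5 (by simp only [Matrix.cons_val]; norm_num [abs_lt])
      have e66 := hY 6 6 (by simp only [Matrix.cons_val]; norm_num [abs_lt])
      simp only [Matrix.cons_val] at e02 e14 e25 e26 e00 e11 e22 e33 e44 e55 e66
      clear hp hq hY
      have h0 : p 0 = 0 ∧ q 0 = 0 := ⟨by linarith, by linarith⟩
      have h1 : p 1 = 0 ∧ q 1 = 0 := ⟨by linarith, by linarith⟩
      have h2 : p 2 = 0 ∧ q 2 = 0 := ⟨by linarith, by linarith⟩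
      have h3 : p 3 = 0 ∧ q 3 = 0 := ⟨by linarith, by linarith⟩
      have h4 : p 4 = 0 ∧ q 4 = 0 := ⟨by linarith, by linarith⟩
      have h5 : p 5 = 0 ∧ q 5 = 0 := ⟨by linarith, by linarith⟩
      have h6 : p 6 = 0 ∧ q 6 = 0 := ⟨by linarith, by linarith⟩
      intro i; fin_cases i
      exacts [h0, h1, h2, h3, h4, h5, h6]
    case count =>
      simp only [Fin.sum_univ_seven, Matrix.cons_val, absOneIndicator, Fintype.card_fin]
      norm_num [abs_div]
    all_goals norm_num [Fin.forall_fin_succ, Fin.sum_univ_succ, abs_le, abs_lt]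
  all_goals norm_num [Fin.forall_fin_succ, Fin.sum_univ_succ, abs_lt]

theorem exists_isKernelCertificate_of_four_le (r : ℕ) (hr : 4 ≤ r) :
    ∃ (κ : Type) (_ : Fintype κ) (x y u v : κ → ℝ) (Y : κ → κ → ℝ) (a b c : ℝ),
      Fintype.card κ = r ∧ IsKernelCertificate x y u v Y a b c ∧ HasSignRelation x y ∧
        HasSignRelation y x := by
  induction r using Nat.strong_induction_on with
  | _ r ih =>
    -- Steps of four need one base case for each residue: `4, 5, 6, 7`.
    rcases lt_or_ge r 8 with h8 | h8
    · interval_cases r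
      · obtain ⟨x, y, u, v, Y, a, b, c, h⟩ := exists_isKernelCertificate_four
        exact ⟨Fin 4, inferInstance, x, y, u, v, Y, a, b, c, Fintype.card_fin 4, h⟩
      · obtain ⟨x, y, u, v, Y, a, b, c, h⟩ := exists_isKernelCertificate_five
        exact ⟨Fin 5, inferInstance, x, y, u, v, Y, a, b, c, Fintype.card_fin 5, h⟩
      · obtain ⟨x, y, u, v, Y, a, b, c, h⟩ := exists_isKernelCertificate_six
        exact ⟨Fin 6, inferInstance, x, y, u, v, Y, a, b, c, Fintype.card_fin 6, h⟩
      · obtain ⟨x, y, u, v, Y, a, b, c, h⟩ := exists_isKernelCertificate_seven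
        exact ⟨Fin 7, inferInstance, x, y, u, v, Y, a, b, c, Fintype.card_fin 7, h⟩
    · obtain ⟨κ, _, x, y, u, v, Y, a, b, c, hcard, h, hα, hβ⟩ :=
        ih (r - 4) (by omega) (by omega)
      obtain ⟨x', y', u', v', Y', a', b', c', h'⟩ := h.exists_extend hα hβ
      refine ⟨κ ⊕ Fin 4, inferInstance, x', y', u', v', Y', a', b', c', ?_, h'⟩
      rw [Fintype.card_sum, hcard, Fintype.card_fin]; omega

theorem exists_sharp_symGinvRegion {n r : ℕ} (hr : 3 ≤ r) (hn : r + 2 ≤ n) :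
    ∃ A : Matrix (Fin n) (Fin n) ℝ, A.IsSymm ∧ A.rank = r ∧
      ∃ p ∈ (symGinvRegion A).extremePoints ℝ, IsLPOptimal (symGinvRegion A) p ∧
        (∀ q, IsLPOptimal (symGinvRegion A) q → q = p) ∧
        nnzEntries (p.1 - p.2) = r ^ 2 + r := by
  rcases hr.eq_or_lt with rfl | hr
  · obtain ⟨x, y, u, v, Y, a, b, c, h⟩ := exists_isKernelCertificate_three
    exact h.exists_sharp (Fintype.card_fin 3) hn
  · obtain ⟨κ, _, x, y, u, v, Y, a, b, c, hcard, h, -, -⟩ :=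
      exists_isKernelCertificate_of_four_le r hr
    exact h.exists_sharp hcard hn

theorem mainTheorem6 :
    -- extreme solutions of the LP for `min {‖H‖₁ : A H A = A}` have at most `r²` nonzeros
    (∀ (n r : ℕ) (A : Matrix (Fin n) (Fin n) ℝ), A.IsSymm → A.rank = r →
      ∀ p ∈ (ginvRegion A).extremePoints ℝ, nnzEntries (p.1 - p.2) ≤ r ^ 2) ∧
    -- this bound is sharp for all `n ≥ r ≥ 1`
    (∀ n r : ℕ, 1 ≤ r → r ≤ n →
      ∃ A : Matrix (Fin n) (Fin n) ℝ, A.IsSymm ∧ A.rank = r ∧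
        ∃ p ∈ (ginvRegion A).extremePoints ℝ,
          IsLPOptimal (ginvRegion A) p ∧
          (∀ q, IsLPOptimal (ginvRegion A) q → q = p) ∧
          nnzEntries (p.1 - p.2) = r ^ 2) ∧
    -- extreme solutions of the LP for `min {‖H‖₁ : A H A = A, Hᵀ = H}` have at most
    -- `r² + r` nonzeros
    (∀ (n r : ℕ) (A : Matrix (Fin n) (Fin n) ℝ), A.IsSymm → A.rank = r →
      ∀ p ∈ (symGinvRegion A).extremePoints ℝ, nnzEntries (p.1 - p.2) ≤ r ^ 2 + r) ∧
    -- this bound is sharp for `n - 2 ≥ r ≥ 3`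
    (∀ n r : ℕ, 3 ≤ r → r + 2 ≤ n →
      ∃ A : Matrix (Fin n) (Fin n) ℝ, A.IsSymm ∧ A.rank = r ∧
        ∃ p ∈ (symGinvRegion A).extremePoints ℝ,
          IsLPOptimal (symGinvRegion A) p ∧
          (∀ q, IsLPOptimal (symGinvRegion A) q → q = p) ∧
          nnzEntries (p.1 - p.2) = r ^ 2 + r) := by
  exact ⟨fun _ _ A _ hr p hp => nnzEntries_le_of_mem_extremePoints_ginvRegion A hr p hp,
    fun _ _ _ hrn => exists_sharp_ginvRegion hrn,
    fun _ _ A hA hr p hp => nnzEntries_le_of_mem_extremePoints_symGinvRegion A hA hr p hp,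
    fun _ _ hr hn => exists_sharp_symGinvRegion hr hn⟩
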